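/- **Setting.** Let $P_{X,S}$ be a probability law on $\mathbb{R}^p\times\mathcal S$, where $\mathcal S$ is a standard Borel space, let $\mathcal Y\subseteq\mathbb{R}^q$ be a Borel set, and let $d:\mathcal S\times\mathcal Y\to[0,\infty]$ be measurable. Put $\bar d(x,y)=E[d(S,y)\mid X=x]$ (through a regular conditional law of $S$ given $X$) and $$R(D)=\inf\{\,I(X;Y): P_{Y|X}\text{ a conditional law on }\mathcal Y,\ E[\bar d(X,Y)]\le D\,\}.$$ Fix $\lambda\ge 0$ and let $P^*_{Y|X}$ be a minimizer of $I(X;Y)+\lambda E[\bar d(X,Y)]$ over all $P_{Y|X}$, with finite minimum. Let $Y^*$ be the corresponding reproduction, $Q^*$ its law, and $D=D_\lambda=E[\bar d(X,Y^*)]$. Let $P_Z$ be a non-atomic probability law on $\mathbb{R}^l$, and let $\sigma:\mathbb{R}\to\mathbb{R}$ be continuous and nondecreasing with limits $0$ at $-\infty$ and $1$ at $+\infty$. For $\theta,\hat\theta\in\mathbb{R}^k$ let $T_\theta:\mathbb{R}^l\to\mathbb{R}^q$ and $g_{\hat\theta}:\mathbb{R}^p\times\mathbb{R}^q\to\mathbb{R}$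 be the feed-forward networks with one hidden layer and activation $\sigma$, i.e. $v\mapsto\sum_h c_h\,\sigma(\langle a_h,v\rangle+b_h)$, with as many hidden units as $k$ parameters allow. For samples $(x_i,s_i)_{i\le n}$ and $(z_j)_{j\le m}$ put $g_{ij}=g_{\hat\theta}(x_i,T_\theta(z_j))$ and $$\widehat{\mathcal L}=-\frac1n\sum_{i=1}^n\log\Big(\frac1m\sum_{j=1}^m e^{-\lambda g_{ij}}\Big),\qquad \widehat D=\frac1n\sum_{i=1}^n\sum_{j=1}^m g_{ij}\,\frac{e^{-\lambda g_{ij}}}{\sum_{j'=1}^m e^{-\lambda g_{ij'}}},\qquad \widehat R(D)=\widehat{\mathcal L}-\lambda\widehat D .$$ **Theorem (strong consistency of NEIRD).** $R(D)$ is finite, and for every $\epsilon>0$ and all sufficiently large $k$ there are compact sets $\Theta,\hat\Theta\subset\mathbb{R}^k$ and parameters $\theta\in\Theta$, $\hat\theta\in\hat\Theta$ such that 1. the law of $T_\theta(Z)$, $Z\sim P_Z$, is within $\epsilon$ of $Q^*$ in the Lévy–Prokhorov distance (for the sup norm on $\mathbb{R}^q$); 2. $g_{\hat\theta}$ approximates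 $\bar d$ in measure: outside a set of $P_X\otimes Q^*$-measure at most $\epsilon$, one has $|g_{\hat\theta}(x,y)-\bar d(x,y)|\le\epsilon$ where $\bar d(x,y)<\infty$, and $g_{\hat\theta}(x,y)\ge 1/\epsilon$ where $\bar d(x,y)=\infty$; 3. for all i.i.d. sequences $(x_i,s_i)_{i\ge1}$ with law $P_{X,S}$ and $(z_j)_{j\ge1}$ with law $P_Z$ on a common probability space, almost surely there are $N$ and $M$ such that $|\widehat R(D)-R(D)|\le\epsilon$ for all $n\ge N$ and $m\ge M$. -/

import Mathlib

open MeasureTheory ProbabilityTheory Filter Topology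
open scoped ENNReal

namespace IndirectRD

noncomputable section

/-! ### The indirect rate-distortion function -/

/-- Reduced distortion measure: `P` is the joint law of the pair (observation `X`, source `S`),
and `dbar P d x y` is the conditional expectation of `d (S, y)` given `X = x`. -/
def dbar {p : ℕ} {S Y : Type*} [MeasurableSpace S] [StandardBorelSpace S] [Nonempty S]
    (P : Measure ((Fin p → ℝ) × S)) [IsFiniteMeasure P] (d : S × Y → ℝ≥0∞)
    (x : Fin p → ℝ) (y : Y) : ℝ≥0∞ :=
  ∫⁻ s, d (s, y) ∂(P.condKernel x)

/-- Law of the reproduction `Y` when `X` has law `PX` and `Y` is generated from `X` by the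
conditional law `κ`. -/
def reproLaw {p : ℕ} {Y : Type*} [MeasurableSpace Y] (PX : Measure (Fin p → ℝ))
    (κ : Kernel (Fin p → ℝ) Y) : Measure Y :=
  κ ∘ₘ PX

/-- Mutual information `I(X; Y)` (in nats), where `X` has law `PX` and `Y` is generated from `X`
by `κ`: the relative entropy of the joint law with respect to the product of the marginals. -/
def mutualInfo {p : ℕ} {Y : Type*} [MeasurableSpace Y] (PX : Measure (Fin p → ℝ))
    (κ : Kernel (Fin p → ℝ) Y) : ℝ≥0∞ :=
  InformationTheory.klDiv (PX ⊗ₘ κ) (PX.prod (reproLaw PX κ))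

/-- Expected reduced distortion of the test channel `κ`. -/
def expDistortion {p : ℕ} {S Y : Type*} [MeasurableSpace S] [StandardBorelSpace S] [Nonempty S]
    [MeasurableSpace Y] (P : Measure ((Fin p → ℝ) × S)) [IsFiniteMeasure P]
    (d : S × Y → ℝ≥0∞) (κ : Kernel (Fin p → ℝ) Y) : ℝ≥0∞ :=
  ∫⁻ x, ∫⁻ y, dbar P d x y ∂(κ x) ∂P.fst

/-- The indirect rate-distortion function `R(D)`. -/
def iRDF {p : ℕ} {S Y : Type*} [MeasurableSpace S] [StandardBorelSpace S] [Nonempty S]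
    [MeasurableSpace Y] (P : Measure ((Fin p → ℝ) × S)) [IsFiniteMeasure P]
    (d : S × Y → ℝ≥0∞) (D : ℝ≥0∞) : ℝ≥0∞ :=
  ⨅ (κ : Kernel (Fin p → ℝ) Y) (_ : IsMarkovKernel κ) (_ : expDistortion P d κ ≤ D),
    mutualInfo P.fst κ

/-- The Lagrangian `I(X; Y) + lam * E[dbar(X, Y)]` of the test channel `κ`. -/
def lagrangian {p : ℕ} {S Y : Type*} [MeasurableSpace S] [StandardBorelSpace S] [Nonempty S]
    [MeasurableSpace Y] (P : Measure ((Fin p → ℝ) × S)) [IsFiniteMeasure P]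
    (d : S × Y → ℝ≥0∞) (lam : ℝ) (κ : Kernel (Fin p → ℝ) Y) : ℝ≥0∞ :=
  mutualInfo P.fst κ + ENNReal.ofReal lam * expDistortion P d κ

/-- `κ` attains the infimum `F(lam)` of the Lagrangian over all test channels, and `F(lam)` is
finite. The point of the curve `R` with slope `-lam` that belongs to `κ` has the abscissa
`expDistortion P d κ`. -/
def IsOptimalChannel {p : ℕ} {S Y : Type*} [MeasurableSpace S] [StandardBorelSpace S]
    [Nonempty S] [MeasurableSpace Y] (P : Measure ((Fin p → ℝ) × S)) [IsFiniteMeasure P]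
    (d : S × Y → ℝ≥0∞) (lam : ℝ) (κ : Kernel (Fin p → ℝ) Y) : Prop :=
  lagrangian P d lam κ ≠ ∞ ∧
    ∀ κ' : Kernel (Fin p → ℝ) Y, IsMarkovKernel κ' →
      lagrangian P d lam κ ≤ lagrangian P d lam κ'

/-! ### Feed-forward networks -/

/-- A continuous squashing function: nondecreasing, with limits `0` and `1` at `-∞` and `∞`. -/
structure IsSquashing (σ : ℝ → ℝ) : Prop where
  continuous : Continuous σ
  monotone : Monotone σ
  tendsto_atBot : Tendsto σ atBot (𝓝 0)
  tendsto_atTop : Tendsto σ atTop (𝓝 1)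

/-- The `i`-th coordinate of a parameter vector, `0` out of range. -/
def coord {k : ℕ} (θ : EuclideanSpace ℝ (Fin k)) (i : ℕ) : ℝ :=
  if h : i < k then θ ⟨i, h⟩ else 0

/-- The feed-forward network from `ℝ^a` to `ℝ^b` with activation `σ`, one hidden layer and
parameter vector `θ` in `ℝ^k`. It has as many hidden units as `k` parameters allow; the `h`-th unit
owns `a + 1 + b` consecutive parameters: `a` input weights, a bias, and `b` output weights. -/
def net (σ : ℝ → ℝ) {k : ℕ} (a b : ℕ) (θ : EuclideanSpace ℝ (Fin k)) (x : Fin a → ℝ) :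
    Fin b → ℝ := fun o =>
  ∑ h ∈ Finset.range (k / (a + 1 + b)),
    coord θ (h * (a + 1 + b) + (a + 1) + o) *
      σ (∑ i : Fin a, coord θ (h * (a + 1 + b) + i) * x i + coord θ (h * (a + 1 + b) + a))

/-- Reproduction-mapping network. -/
def reproNet (σ : ℝ → ℝ) {k l q : ℕ} (θ : EuclideanSpace ℝ (Fin k)) (z : Fin l → ℝ) :
    Fin q → ℝ :=
  net σ l q θ z

/-- Distortion-estimator network, fed with the concatenation of `x` and `y`. -/
def distNet (σ : ℝ → ℝ) {k p q : ℕ} (θ : EuclideanSpace ℝ (Fin k)) (x : Fin p → ℝ)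
    (y : Fin q → ℝ) : ℝ :=
  net σ (p + q) 1 θ (Fin.append x y) 0

/-! ### The empirical estimate -/

/-- Empirical Lagrangian from the first `n` observations `x i` and the first `m` base samples
`z j`, for a distortion estimator `g` and a reproduction mapping `T`. -/
def empL {𝒳 𝒴 𝒵 : Type*} (lam : ℝ) (g : 𝒳 → 𝒴 → ℝ) (T : 𝒵 → 𝒴) (x : ℕ → 𝒳) (z : ℕ → 𝒵)
    (n m : ℕ) : ℝ :=
  -((1 / (n : ℝ)) * ∑ i ∈ Finset.range n,
    Real.log ((1 / (m : ℝ)) * ∑ j ∈ Finset.range m, Real.exp (-lam * g (x i) (T (z j)))))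

/-- Empirical distortion: the average over the observations of the mean of `g (x i) (T (z j))`
over `j` with normalized weights proportional to `exp (-lam * g (x i) (T (z j)))`. -/
def empD {𝒳 𝒴 𝒵 : Type*} (lam : ℝ) (g : 𝒳 → 𝒴 → ℝ) (T : 𝒵 → 𝒴) (x : ℕ → 𝒳) (z : ℕ → 𝒵)
    (n m : ℕ) : ℝ :=
  (1 / (n : ℝ)) * ∑ i ∈ Finset.range n, ∑ j ∈ Finset.range m,
    g (x i) (T (z j)) * (Real.exp (-lam * g (x i) (T (z j))) /
      ∑ j' ∈ Finset.range m, Real.exp (-lam * g (x i) (T (z j'))))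

/-- Empirical estimate of the rate. -/
def empR {𝒳 𝒴 𝒵 : Type*} (lam : ℝ) (g : 𝒳 → 𝒴 → ℝ) (T : 𝒵 → 𝒴) (x : ℕ → 𝒳) (z : ℕ → 𝒵)
    (n m : ℕ) : ℝ :=
  empL lam g T x z n m - lam * empD lam g T x z n m

/-- The real number `t` is `ε`-close to the extended number `a`: within `ε` of it when `a` is
finite, and at least `1 / ε` when `a = ∞`. -/
def CloseTo (ε t : ℝ) (a : ℝ≥0∞) : Prop :=
  (a ≠ ∞ → |t - a.toReal| ≤ ε) ∧ (a = ∞ → 1 / ε ≤ t)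

end

end IndirectRD

namespace IndirectRD

/-! The link between theory and estimator is the Gibbs rate. For a weight `u ≥ 0` with positive
mean, `gibbsRate Q u` is the relative entropy with respect to `Q` of the law with density
proportional to `u`.

On the theoretical side, a minimizer of the Lagrangian is the Gibbs channel with weight `exp (-λ
d̄(x, ·))` relative to its own reproduction law `Q*` (`optimal_channel_gibbs`). Let `M` be its joint
law and `N` the joint law of that Gibbs channel. The Lagrangian of the minimizer is `KL(M ‖ N) - E
log Z(X)`, where `Z` is the normalizing factor. The Gibbs channel achieves at most `- E log Z(X)`,
so minimality forces `M = N`. Its mutual information is therefore the mean over `X` of the Gibbs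
rates. It equals `R(D)`, because a minimizer of the Lagrangian lies on a supporting line of the
curve (`iRDF_eq_mutualInfo`). On the empirical side, `empR` is exactly the sample mean of the rates
of the empirical Gibbs laws (`empR_eq`).

What remains is stability of the mean rate under four replacements: `d̄` by its truncation at a
level `n`, the truncation by a network, `Q*` by the law of a network, and expectations by sample
means. Truncation is controlled by `-log Z`, which is integrable by optimality
(`tendsto_integral_gibbsRate_truncate`). The other replacements involve only weights bounded above
and away from `0`.

Networks enter through a closure argument. Their closure under bounded pointwise limits contains
every bounded measurable function (`ridge_closure_measurable`), and a condition that is open for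
such limits passes back to some network (`BddClosure.exists_mem_of_open`). One network can thus be
close to the truncation both in mean and in rate. Non-atomicity gives an exact measurable transport
of the base law to `Q*`, whose coordinates are approximated almost everywhere by networks. Once the
networks are fixed, the strong law in a Banach space of bounded continuous functions makes the
convergence in `m` uniform in `x`, so that `N` and `M` do not depend on each other. -/

/-! ### Closure under bounded pointwise limits -/

/-- The closure of a set of functions under pointwise limits of uniformly bounded sequences. -/
inductive BddClosure {α : Type*} (N : Set (α → ℝ)) : (α → ℝ) → Prop
  | base {f : α → ℝ} : f ∈ N → BddClosure N f
  | lim {f : ℕ → α → ℝ} {g : α → ℝ} {C : ℝ} : (∀ n, BddClosure N (f n)) →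
      (∀ n x, |f n x| ≤ C) → (∀ x, Tendsto (fun n => f n x) atTop (𝓝 (g x))) → BddClosure N g

namespace BddClosure

variable {α β : Type*}

lemma bounded {N : Set (α → ℝ)} (hN : ∀ f ∈ N, ∃ C, ∀ x, |f x| ≤ C) {f : α → ℝ}
    (hf : BddClosure N f) : ∃ C, ∀ x, |f x| ≤ C := by
  cases hf with
  | base h => exact hN _ h
  | lim h1 h2 h3 => exact ⟨_, fun x => le_of_tendsto (h3 x).abs (Eventually.of_forall fun n => h2 n x)⟩

lemma measurable [MeasurableSpace α] {N : Set (α → ℝ)} (hN : ∀ f ∈ N, Measurable f) {f : α → ℝ}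
    (hf : BddClosure N f) : Measurable f := by
  induction hf with
  | base h => exact hN _ h
  | lim _ _ h3 ih => exact measurable_of_tendsto_metrizable ih (tendsto_pi_nhds.2 h3)

lemma comp {N : Set (α → ℝ)} {N' : Set (β → ℝ)} (φ : β → α)
    (h : ∀ f ∈ N, BddClosure N' (f ∘ φ)) {f : α → ℝ} (hf : BddClosure N f) :
    BddClosure N' (f ∘ φ) := by
  induction hf with
  | base hf => exact h _ hf
  | lim _ h2 h3 ih => exact lim ih (fun n x => h2 n (φ x)) (fun x => h3 (φ x))

/-- A property of functions that is open for bounded pointwise convergence and holds for some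
function of the closure holds for some function of the original set. -/
lemma exists_mem_of_open {N : Set (α → ℝ)} (O : (α → ℝ) → Prop)
    (hO : ∀ (f : ℕ → α → ℝ) (g : α → ℝ) (C : ℝ), (∀ n, BddClosure N (f n)) →
      (∀ n x, |f n x| ≤ C) → (∀ x, Tendsto (fun n => f n x) atTop (𝓝 (g x))) → O g →
      ∃ n, O (f n)) {f : α → ℝ} (hf : BddClosure N f) (h : O f) : ∃ g ∈ N, O g := by
  induction hf with
  | base hf => exact ⟨_, hf, h⟩
  | lim h1 h2 h3 ih =>
    obtain ⟨n, hn⟩ := hO _ _ _ h1 h2 h3 h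
    exact ih n hn

variable {N : Submodule ℝ (α → ℝ)}

lemma smul (c : ℝ) {f : α → ℝ} (hf : BddClosure (N : Set (α → ℝ)) f) :
    BddClosure (N : Set (α → ℝ)) (c • f) := by
  induction hf with
  | base h => exact base (N.smul_mem c h)
  | @lim f g C _ h2 h3 ih =>
    refine lim (C := |c| * C) ih (fun n x => ?_) (fun x => (h3 x).const_mul c)
    simpa [abs_mul] using mul_le_mul_of_nonneg_left (h2 n x) (abs_nonneg c)

/-- A limit can be taken in one summand only while the other stays fixed and bounded. Hence the
nested inductions: first over `g` with `f` in the original set, then over `f` with `g` arbitrary in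
the closure. -/
lemma add (hN : ∀ f ∈ N, ∃ C, ∀ x, |f x| ≤ C) {f g : α → ℝ}
    (hf : BddClosure (N : Set (α → ℝ)) f) (hg : BddClosure (N : Set (α → ℝ)) g) :
    BddClosure (N : Set (α → ℝ)) (f + g) := by
  induction hf with
  | @base f h =>
    induction hg with
    | base h' => exact base (N.add_mem h h')
    | @lim f' g' C _ h2 h3 ih =>
      obtain ⟨B, hB⟩ := hN _ h
      exact lim (C := B + C) ih (fun n x => (abs_add_le _ _).trans (add_le_add (hB x) (h2 n x)))
        (fun x => (h3 x).const_add (f x))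
  | @lim f' g' C _ h2 h3 ih =>
    obtain ⟨B, hB⟩ := bounded hN hg
    exact lim (C := C + B) ih (fun n x => (abs_add_le _ _).trans (add_le_add (h2 n x) (hB x)))
      (fun x => (h3 x).add_const (g x))

lemma zero : BddClosure (N : Set (α → ℝ)) 0 := base N.zero_mem

variable [MeasurableSpace α]

/-- The functional monotone class theorem: indicators. -/
lemma indicator_of_measurableSet (hN : ∀ f ∈ N, ∃ C, ∀ x, |f x| ≤ C) (s : Set (Set α))
    (hgen : (inferInstance : MeasurableSpace α) = MeasurableSpace.generateFrom s)
    (hpi : IsPiSystem s)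
    (hone : BddClosure (N : Set (α → ℝ)) 1)
    (hs : ∀ t ∈ s, BddClosure (N : Set (α → ℝ)) (t.indicator 1)) {t : Set α}
    (ht : MeasurableSet t) : BddClosure (N : Set (α → ℝ)) (t.indicator 1) := by
  induction t, ht using MeasurableSpace.induction_on_inter hgen hpi with
  | empty => rw [Set.indicator_empty]; exact zero
  | basic t ht => exact hs t ht
  | compl t _ ih =>
    have := add hN hone (smul (-1) ih)
    rw [Set.indicator_compl]
    convert this using 1
    ext x; simp [sub_eq_add_neg]
  | iUnion t hd hm ih =>
    -- Finite partial unions are disjoint sums of indicators; the full union is their pointwise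
    -- limit, bounded by 1.
    have hsum : ∀ n, BddClosure (N : Set (α → ℝ)) ((⋃ i ∈ Finset.range n, t i).indicator 1) := by
      intro n
      induction n with
      | zero =>
        simp only [Finset.range_zero, Finset.notMem_empty, Set.iUnion_of_empty, Set.iUnion_empty,
          Set.indicator_empty]
        exact zero
      | succ n ihn =>
        convert add hN (ih n) ihn using 1
        rw [Finset.range_add_one, Finset.set_biUnion_insert, Set.indicator_union_of_disjoint]
        · rfl
        · rw [Set.disjoint_iUnion₂_right]
          intro i hi
          exact hd (by simpa using (Finset.mem_range.1 hi).ne')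
    refine lim (C := 1) hsum (fun n x => ?_) (fun x => ?_)
    · by_cases hx : x ∈ ⋃ i ∈ Finset.range n, t i <;> simp only [Set.indicator, hx] <;> simp
    · by_cases hx : x ∈ ⋃ i, t i
      · obtain ⟨i, hi⟩ := Set.mem_iUnion.1 hx
        refine tendsto_const_nhds.congr' ?_
        filter_upwards [eventually_gt_atTop i] with n hn
        have : x ∈ ⋃ i ∈ Finset.range n, t i := Set.mem_biUnion (by simpa using hn) hi
        rw [Set.indicator_of_mem hx, Set.indicator_of_mem this]
      · refine tendsto_const_nhds.congr fun n => ?_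
        have : x ∉ ⋃ i ∈ Finset.range n, t i := fun h => hx (by
          simp only [Set.mem_iUnion] at h ⊢
          obtain ⟨i, _, hi⟩ := h
          exact ⟨i, hi⟩)
        rw [Set.indicator_of_notMem hx, Set.indicator_of_notMem this]

/-- The functional monotone class theorem: bounded measurable functions. -/
lemma of_measurable (hN : ∀ f ∈ N, ∃ C, ∀ x, |f x| ≤ C) (s : Set (Set α))
    (hgen : (inferInstance : MeasurableSpace α) = MeasurableSpace.generateFrom s)
    (hpi : IsPiSystem s)
    (hone : BddClosure (N : Set (α → ℝ)) 1)
    (hs : ∀ t ∈ s, BddClosure (N : Set (α → ℝ)) (t.indicator 1)) {f : α → ℝ}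
    (hf : Measurable f) {C : ℝ} (hC : ∀ x, |f x| ≤ C) : BddClosure (N : Set (α → ℝ)) f := by
  have hsimple : ∀ g : SimpleFunc α ℝ, BddClosure (N : Set (α → ℝ)) g := by
    intro g
    induction g using SimpleFunc.induction with
    | const c ht =>
      convert smul c (indicator_of_measurableSet hN s hgen hpi hone hs ht) using 1
      ext x
      simp [Set.indicator, Set.piecewise]
    | add _ h1 h2 => exact add hN h1 h2
  -- A point of `α` is needed to deduce `0 ≤ C` from the bound.
  rcases isEmpty_or_nonempty α with h | ⟨⟨x₀⟩⟩
  · rw [show f = 0 from funext fun x => h.elim x]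
    exact zero
  exact lim (C := C) (fun n => hsimple (hf.stronglyMeasurable.approxBounded C n))
    (fun n x => hf.stronglyMeasurable.norm_approxBounded_le ((abs_nonneg _).trans (hC x₀)) n x)
    (fun x => hf.stronglyMeasurable.tendsto_approxBounded_of_norm_le (hC x))

end BddClosure

/-! ### Density of networks -/

namespace IsSquashing

variable {σ : ℝ → ℝ}

lemma nonneg (hσ : IsSquashing σ) (t : ℝ) : 0 ≤ σ t := hσ.monotone.le_of_tendsto hσ.tendsto_atBot t

lemma le_one (hσ : IsSquashing σ) (t : ℝ) : σ t ≤ 1 := hσ.monotone.ge_of_tendsto hσ.tendsto_atTop t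

lemma abs_le_one (hσ : IsSquashing σ) (t : ℝ) : |σ t| ≤ 1 := by
  rw [abs_of_nonneg (hσ.nonneg t)]; exact hσ.le_one t

end IsSquashing

/-- The space of scalar one-hidden-layer networks on `ℝ^d` with activation `σ`. -/
def ridge (σ : ℝ → ℝ) (d : ℕ) : Submodule ℝ ((Fin d → ℝ) → ℝ) :=
  Submodule.span ℝ (Set.range fun (ab : (Fin d → ℝ) × ℝ) (x : Fin d → ℝ) =>
    σ (∑ i, ab.1 i * x i + ab.2))

section Density

variable {σ : ℝ → ℝ} {d : ℕ}

lemma bounded_of_mem_span {α : Type*} {s : Set (α → ℝ)} (hs : ∀ f ∈ s, ∃ C, ∀ x, |f x| ≤ C) :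
    ∀ f ∈ Submodule.span ℝ s, ∃ C, ∀ x, |f x| ≤ C := by
  intro f hf
  induction hf using Submodule.span_induction with
  | mem f hf => exact hs f hf
  | zero => exact ⟨0, fun x => by simp⟩
  | add f g _ _ h1 h2 =>
    obtain ⟨C, hC⟩ := h1
    obtain ⟨B, hB⟩ := h2
    exact ⟨C + B, fun x => (abs_add_le _ _).trans (add_le_add (hC x) (hB x))⟩
  | smul c f _ h1 =>
    obtain ⟨C, hC⟩ := h1
    refine ⟨|c| * C, fun x => ?_⟩
    simpa [abs_mul] using mul_le_mul_of_nonneg_left (hC x) (abs_nonneg c)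

lemma ridge_bounded (hσ : IsSquashing σ) : ∀ f ∈ ridge σ d, ∃ C, ∀ x, |f x| ≤ C := by
  refine bounded_of_mem_span ?_
  rintro _ ⟨ab, rfl⟩
  exact ⟨1, fun x => hσ.abs_le_one _⟩

lemma ridge_continuous (hσ : IsSquashing σ) : ∀ f ∈ ridge σ d, Continuous f := by
  intro f hf
  induction hf using Submodule.span_induction with
  | mem f hf => obtain ⟨ab, rfl⟩ := hf; exact hσ.continuous.comp (by fun_prop)
  | zero => exact continuous_const
  | add f g _ _ h1 h2 => exact h1.add h2
  | smul c f _ h1 => exact h1.const_smul c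

/-- Steep squashing functions converge to indicators of half-lines. -/
lemma tendsto_squash_indicator (hσ : IsSquashing σ) (c t : ℝ) :
    Tendsto (fun n : ℕ => σ (n * t + (-(n * c) + √n))) atTop
      (𝓝 ((Set.Ici c).indicator 1 t)) := by
  -- The argument of `σ` is `n (t - c) + √n`. The shift `√n` gives the boundary point `t = c` the
  -- limit 1, and is negligible against `n (t - c)` when `t < c`.
  have hsq : Tendsto (fun n : ℕ => √(n : ℝ)) atTop atTop :=
    Real.tendsto_sqrt_atTop.comp tendsto_natCast_atTop_atTop
  by_cases h : c ≤ t
  · rw [Set.indicator_of_mem (show t ∈ Set.Ici c from h)]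
    refine hσ.tendsto_atTop.comp (tendsto_atTop_mono (fun n => ?_) hsq)
    have : (0:ℝ) ≤ n * (t - c) := mul_nonneg n.cast_nonneg (sub_nonneg.2 h)
    linarith
  · rw [Set.indicator_of_notMem (show t ∉ Set.Ici c from h)]
    push Not at h
    refine hσ.tendsto_atBot.comp ?_
    have h1 : Tendsto (fun n : ℕ => √(n : ℝ) * (√n * (t - c) + 1)) atTop atBot := by
      refine hsq.atTop_mul_atBot₀ (tendsto_atBot_add_const_right _ _ ?_)
      exact hsq.atTop_mul_const_of_neg (sub_neg.2 h)
    refine h1.congr fun n => ?_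
    have : √(n : ℝ) * √n = n := Real.mul_self_sqrt n.cast_nonneg
    linear_combination (t - c) * this

/-- Every bounded measurable function of a linear form is in the closure of the networks. -/
lemma ridge_closure_linear (hσ : IsSquashing σ) (a : Fin d → ℝ) {φ : ℝ → ℝ} (hφ : Measurable φ)
    {C : ℝ} (hC : ∀ t, |φ t| ≤ C) :
    BddClosure (ridge σ d : Set ((Fin d → ℝ) → ℝ)) (fun x => φ (∑ i, a i * x i)) := by
  -- The monotone class argument takes place on `ℝ`, where the half-lines `[c, ∞)` form a generating
  -- π-system; the result is then pulled back along the linear form.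
  let N₁ : Submodule ℝ (ℝ → ℝ) := Submodule.span ℝ
    (Set.range fun (ab : ℝ × ℝ) (t : ℝ) => σ (ab.1 * t + ab.2))
  have hN₁ : ∀ f ∈ N₁, ∃ C, ∀ x, |f x| ≤ C := by
    refine bounded_of_mem_span ?_
    rintro _ ⟨ab, rfl⟩
    exact ⟨1, fun x => hσ.abs_le_one _⟩
  have h1 : BddClosure (N₁ : Set (ℝ → ℝ)) φ := by
    refine BddClosure.of_measurable hN₁ (Set.range Set.Ici) ?_ ?_ ?_ ?_ hφ hC
    · exact (BorelSpace.measurable_eq (α := ℝ)).trans (borel_eq_generateFrom_Ici ℝ)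
    · exact isPiSystem_Ici
    · refine BddClosure.lim (f := fun (n : ℕ) _ => σ (0 * 0 + n)) (C := 1) (fun n => ?_)
        (fun n x => hσ.abs_le_one _) (fun x => ?_)
      · have : (fun _ => σ (0 * 0 + n)) ∈ N₁ := Submodule.subset_span ⟨(0, n), by simp⟩
        exact .base this
      · simpa [Function.comp_def] using hσ.tendsto_atTop.comp tendsto_natCast_atTop_atTop
    · rintro _ ⟨c, rfl⟩
      refine BddClosure.lim (C := 1) (fun n => ?_) (fun n x => hσ.abs_le_one _)
        (fun t => tendsto_squash_indicator hσ c t)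
      exact .base (Submodule.subset_span ⟨(n, -(n * c) + √n), rfl⟩)
  refine h1.comp (fun x : Fin d → ℝ => ∑ i, a i * x i) fun f hf => .base ?_
  induction hf using Submodule.span_induction with
  | mem f hf =>
    obtain ⟨ab, rfl⟩ := hf
    refine Submodule.subset_span ⟨(ab.1 • a, ab.2), ?_⟩
    ext x
    simp [Finset.mul_sum, mul_assoc]
  | zero => exact (ridge σ d).zero_mem
  | add f g _ _ h1 h2 => exact (ridge σ d).add_mem h1 h2
  | smul c f _ h1 => exact (ridge σ d).smul_mem c h1

/-- The space of real trigonometric polynomials on `ℝ^d`. -/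
def trigPoly (d : ℕ) : Submodule ℝ ((Fin d → ℝ) → ℝ) :=
  Submodule.span ℝ (Set.range fun (ab : (Fin d → ℝ) × ℝ) (x : Fin d → ℝ) =>
    Real.cos (∑ i, ab.1 i * x i + ab.2))

/-- Product-to-sum formula for cosines. Closure under products is what ridge functions of a general
`σ` lack and what Stone–Weierstrass needs. -/
lemma trigPoly_mul {f g : (Fin d → ℝ) → ℝ} (hf : f ∈ trigPoly d) (hg : g ∈ trigPoly d) :
    f * g ∈ trigPoly d := by
  induction hf using Submodule.span_induction with
  | mem f hf =>
    obtain ⟨ab, rfl⟩ := hf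
    induction hg using Submodule.span_induction with
    | mem g hg =>
      obtain ⟨ab', rfl⟩ := hg
      have h1 : (1 / 2 : ℝ) • ((fun x => Real.cos (∑ i, (ab.1 + ab'.1) i * x i + (ab.2 + ab'.2))) +
          fun x => Real.cos (∑ i, (ab.1 - ab'.1) i * x i + (ab.2 - ab'.2))) ∈ trigPoly d :=
        (trigPoly d).smul_mem _ ((trigPoly d).add_mem (Submodule.subset_span ⟨ab + ab', rfl⟩)
          (Submodule.subset_span ⟨ab - ab', rfl⟩))
      convert h1 using 1
      ext x
      simp only [Pi.mul_apply, Pi.smul_apply, Pi.add_apply, Pi.sub_apply, smul_eq_mul, add_mul,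
        sub_mul, Finset.sum_add_distrib, Finset.sum_sub_distrib]
      rw [show ∑ i, ab.1 i * x i + ∑ i, ab'.1 i * x i + (ab.2 + ab'.2) =
          (∑ i, ab.1 i * x i + ab.2) + (∑ i, ab'.1 i * x i + ab'.2) by ring,
        show ∑ i, ab.1 i * x i - ∑ i, ab'.1 i * x i + (ab.2 - ab'.2) =
          (∑ i, ab.1 i * x i + ab.2) - (∑ i, ab'.1 i * x i + ab'.2) by ring,
        Real.cos_add (∑ i, ab.1 i * x i + ab.2), Real.cos_sub (∑ i, ab.1 i * x i + ab.2)]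
      ring
    | zero => rw [mul_zero]; exact (trigPoly d).zero_mem
    | add f g _ _ h1 h2 => rw [mul_add]; exact (trigPoly d).add_mem h1 h2
    | smul c f _ h1 => rw [mul_smul_comm]; exact (trigPoly d).smul_mem c h1
  | zero => rw [zero_mul]; exact (trigPoly d).zero_mem
  | add f g _ _ h1 h2 => rw [add_mul]; exact (trigPoly d).add_mem h1 h2
  | smul c f _ h1 => rw [smul_mul_assoc]; exact (trigPoly d).smul_mem c h1

lemma ridge_closure_trigPoly (hσ : IsSquashing σ) {f : (Fin d → ℝ) → ℝ} (hf : f ∈ trigPoly d) :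
    BddClosure (ridge σ d : Set ((Fin d → ℝ) → ℝ)) f := by
  induction hf using Submodule.span_induction with
  | mem f hf =>
    obtain ⟨ab, rfl⟩ := hf
    exact ridge_closure_linear hσ ab.1 (φ := fun t => Real.cos (t + ab.2)) (C := 1)
      (by fun_prop) (fun t => Real.abs_cos_le_one _)
  | zero => exact .zero
  | add f g _ _ h1 h2 => exact .add (ridge_bounded hσ) h1 h2
  | smul c f _ h1 => exact .smul c h1

/-- The coordinatewise sine with period `2 * π * L`, as a map to the cube. -/
noncomputable def sineMap (d : ℕ) (L : ℝ) (x : Fin d → ℝ) :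
    Set.Icc (fun _ => -1 : Fin d → ℝ) (fun _ => 1) :=
  ⟨fun i => Real.sin (x i / L), fun _ => Real.neg_one_le_sin _, fun _ => Real.sin_le_one _⟩

/-- Stone–Weierstrass on the cube: the coordinates generate a point-separating algebra, and
composition with `sineMap` turns its elements into trigonometric polynomials. -/
lemma ridge_closure_comp_sineMap (hσ : IsSquashing σ) (L : ℝ)
    (f : C(Set.Icc (fun _ => -1 : Fin d → ℝ) (fun _ => 1), ℝ)) :
    BddClosure (ridge σ d : Set ((Fin d → ℝ) → ℝ)) (fun x => f (sineMap d L x)) := by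
  let A : Subalgebra ℝ C(Set.Icc (fun _ => -1 : Fin d → ℝ) (fun _ => 1), ℝ) :=
    Algebra.adjoin ℝ (Set.range fun i : Fin d => ⟨fun u => u.1 i, (continuous_apply i).comp continuous_subtype_val⟩)
  have hA : A.SeparatesPoints := by
    intro u v huv
    obtain ⟨i, hi⟩ := Function.ne_iff.1 (fun h => huv (Subtype.ext h))
    exact ⟨_, ⟨⟨fun u => u.1 i, (continuous_apply i).comp continuous_subtype_val⟩, Algebra.subset_adjoin ⟨i, rfl⟩, rfl⟩, hi⟩
  have htrig : ∀ g ∈ A, (fun x => g (sineMap d L x)) ∈ trigPoly d := by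
    intro g hg
    induction hg using Algebra.adjoin_induction with
    | mem g hg =>
      obtain ⟨i, rfl⟩ := hg
      -- The phase comes from `sin t = cos (t - π / 2)`.
      refine Submodule.subset_span ⟨(Pi.single i (1 / L), -(Real.pi / 2)), ?_⟩
      ext x
      simp only [sineMap, ContinuousMap.coe_mk]
      rw [← Real.cos_sub_pi_div_two, Finset.sum_eq_single i]
      · simp [sub_eq_add_neg, div_eq_inv_mul]
      · intro j _ hj; simp [hj]
      · simp
    | algebraMap r =>
      have h1 : r • (fun x : Fin d → ℝ => Real.cos (∑ i, (0 : Fin d → ℝ) i * x i + 0)) ∈ trigPoly d :=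
        (trigPoly d).smul_mem r (Submodule.subset_span ⟨(0, 0), rfl⟩)
      convert h1 using 1
      ext x
      simp
    | add g h _ _ h1 h2 => exact (trigPoly d).add_mem h1 h2
    | mul g h _ _ h1 h2 => exact trigPoly_mul h1 h2
  have happ : ∀ n : ℕ, ∃ g : A, ‖(g : C(Set.Icc (fun _ => -1 : Fin d → ℝ) (fun _ => 1), ℝ)) - f‖ <
      1 / ((n : ℝ) + 1) := fun n =>
    ContinuousMap.exists_mem_subalgebra_near_continuousMap_of_separatesPoints A hA f _
      Nat.one_div_pos_of_nat
  choose g hg using happ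
  have hgf : ∀ n u, |(g n).1 u - f u| < 1 / ((n : ℝ) + 1) := fun n u =>
    lt_of_le_of_lt (ContinuousMap.norm_coe_le_norm ((g n).1 - f) u) (hg n)
  refine BddClosure.lim (C := 1 + ‖f‖) (fun n => ridge_closure_trigPoly hσ (htrig _ (g n).2))
    (fun n x => ?_) (fun x => ?_)
  · have h1 := hgf n (sineMap d L x)
    have h2 : |f (sineMap d L x)| ≤ ‖f‖ := f.norm_coe_le_norm _
    have h3 : 1 / ((n : ℝ) + 1) ≤ 1 := by
      rw [div_le_one (by positivity)]; linarith [n.cast_nonneg (α := ℝ)]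
    have h4 := abs_sub_abs_le_abs_sub ((g n).1 (sineMap d L x)) (f (sineMap d L x))
    linarith
  · rw [tendsto_iff_norm_sub_tendsto_zero]
    exact squeeze_zero (fun _ => norm_nonneg _) (fun n => (hgf n _).le)
      tendsto_one_div_add_atTop_nhds_zero_nat

lemma tendsto_mul_sin_div (t : ℝ) :
    Tendsto (fun n : ℕ => ((n : ℝ) + 1) * Real.sin (t / (n + 1))) atTop (𝓝 t) := by
  by_cases ht : t = 0
  · simp [ht]
  have h0 : Tendsto (fun n : ℕ => t / ((n : ℝ) + 1)) atTop (𝓝[≠] 0) := by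
    refine tendsto_nhdsWithin_iff.2 ⟨?_, Eventually.of_forall fun n => ?_⟩
    · simpa [div_eq_mul_inv] using tendsto_one_div_add_atTop_nhds_zero_nat.const_mul t
    · exact div_ne_zero ht (by positivity)
  have h1 := (Real.hasDerivAt_sin 0).tendsto_slope.comp h0
  have h2 := h1.const_mul t
  simp only [Real.cos_zero, mul_one] at h2
  refine h2.congr fun n => ?_
  have : (n : ℝ) + 1 ≠ 0 := by positivity
  simp only [Function.comp, slope, vsub_eq_sub, sub_zero, Real.sin_zero, smul_eq_mul]
  field_simp

/-- As `L → ∞`, `L sin (x / L) → x` in each coordinate, so `f` is a bounded pointwise limit of the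
periodic functions `f (L sin (x / L))`. -/
lemma ridge_closure_continuous (hσ : IsSquashing σ) {f : (Fin d → ℝ) → ℝ} (hf : Continuous f)
    {C : ℝ} (hC : ∀ x, |f x| ≤ C) : BddClosure (ridge σ d : Set ((Fin d → ℝ) → ℝ)) f := by
  refine BddClosure.lim (C := C) (fun n : ℕ => ridge_closure_comp_sineMap hσ ((n : ℝ) + 1)
    ⟨fun u => f (((n : ℝ) + 1) • u.1), by fun_prop⟩) (fun n x => hC _) (fun x => ?_)
  refine (hf.tendsto x).comp ?_
  rw [tendsto_pi_nhds]
  exact fun i => tendsto_mul_sin_div (x i)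

/-- **Density of networks**: every bounded measurable function is in the closure of the
one-hidden-layer networks under bounded pointwise limits. -/
theorem ridge_closure_measurable (hσ : IsSquashing σ) {f : (Fin d → ℝ) → ℝ} (hf : Measurable f)
    {C : ℝ} (hC : ∀ x, |f x| ≤ C) : BddClosure (ridge σ d : Set ((Fin d → ℝ) → ℝ)) f := by
  refine BddClosure.of_measurable (ridge_bounded hσ) {s | IsClosed s} ?_ isPiSystem_isClosed ?_ ?_ hf hC
  · exact (BorelSpace.measurable_eq (α := Fin d → ℝ)).trans borel_eq_generateFrom_isClosed
  · exact ridge_closure_continuous hσ (f := 1) continuous_const (C := 1) (by simp)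
  · intro t ht
    -- The indicator of a closed set is the limit of its continuous thickened indicators as the
    -- radius shrinks.
    have hpos : ∀ n : ℕ, 0 < 1 / ((n : ℝ) + 1) := fun n => Nat.one_div_pos_of_nat
    refine BddClosure.lim (C := 1) (f := fun n x => (thickenedIndicator (hpos n) t x : ℝ))
      (fun n => ?_) (fun n x => ?_) (fun x => ?_)
    · refine ridge_closure_continuous hσ (by fun_prop) (C := 1) fun x => ?_
      rw [NNReal.abs_eq]; exact_mod_cast thickenedIndicator_le_one _ _ _
    · rw [NNReal.abs_eq]; exact_mod_cast thickenedIndicator_le_one _ _ _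
    · have h1 := thickenedIndicator_tendsto_indicator_closure hpos
        tendsto_one_div_add_atTop_nhds_zero_nat t
      rw [ht.closure_eq] at h1
      have h2 := (tendsto_pi_nhds.1 h1 x)
      have h3 := (NNReal.continuous_coe.tendsto _).comp h2
      have h4 : t.indicator (1 : (Fin d → ℝ) → ℝ) x =
          ((t.indicator (fun _ => 1) x : NNReal) : ℝ) := by
        by_cases hx : x ∈ t
        · simp only [Set.indicator_of_mem hx, Pi.one_apply, NNReal.coe_one]
        · simp only [Set.indicator_of_notMem hx, NNReal.coe_zero]
      rw [h4]
      exact h3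

end Density

/-! ### Networks as parametrized families -/

/-- Weights stored as a table `W` (unit, slot) are flattened in blocks of length `s`; division with
remainder recovers the entry. -/
lemma coord_mk {s k : ℕ} (W : ℕ → ℕ → ℝ) {h r : ℕ} (hh : h < k / s) (hr : r < s) :
    coord (WithLp.toLp 2 fun i : Fin k => W (i / s) (i % s)) (h * s + r) = W h r := by
  have hs : 0 < s := by omega
  have h1 : h * s + r < k := by
    have h2 : (h + 1) * s ≤ k := (Nat.le_div_iff_mul_le hs).1 hh
    linarith [add_one_mul h s]
  simp only [coord, h1, dif_pos]
  rw [Nat.mul_comm, Nat.mul_add_div hs, Nat.mul_add_mod, Nat.div_eq_of_lt hr, Nat.mod_eq_of_lt hr,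
    add_zero]

/-- A map all of whose components are in `ridge` is a network with any sufficiently large number
of parameters. -/
lemma exists_net_eq {σ : ℝ → ℝ} {a b : ℕ} (T : (Fin a → ℝ) → Fin b → ℝ)
    (hT : ∀ o, (fun x => T x o) ∈ ridge σ a) :
    ∃ k₀ : ℕ, ∀ k ≥ k₀, ∃ θ : EuclideanSpace ℝ (Fin k), ∀ x, net σ a b θ x = T x := by
  have h1 : ∀ o, ∃ (n : ℕ) (c : Fin n → ℝ) (w : Fin n → (Fin a → ℝ) × ℝ),
      ∀ x, T x o = ∑ i, c i * σ (∑ j, (w i).1 j * x j + (w i).2) := by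
    intro o
    obtain ⟨n, c, g, hg⟩ := Submodule.mem_span_set'.1 (hT o)
    choose w hw using fun i => (g i).2
    refine ⟨n, c, w, fun x => ?_⟩
    have := congrFun hg x
    simp only [← hw] at this
    simpa using this.symm
  choose n c w hw using h1
  -- The output components share one hidden layer: each summand of each component gets its own unit,
  -- whose output weights vanish except at that component.
  let c' : (Σ o, Fin (n o)) → ℝ := fun p => c p.1 p.2
  let w' : (Σ o, Fin (n o)) → (Fin a → ℝ) × ℝ := fun p => w p.1 p.2
  obtain ⟨H, ⟨e⟩⟩ : ∃ H, Nonempty (Fin H ≃ Σ o, Fin (n o)) := ⟨_, ⟨(Fintype.equivFin _).symm⟩⟩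
  let W : ℕ → ℕ → ℝ := fun h r => if hh : h < H then
    (if hr : r < a then (w' (e ⟨h, hh⟩)).1 ⟨r, hr⟩
      else if r = a then (w' (e ⟨h, hh⟩)).2
      else if r - (a + 1) = (e ⟨h, hh⟩).1 then c' (e ⟨h, hh⟩) else 0) else 0
  have hW1 : ∀ (h : Fin H) (i : Fin a), W h i = (w' (e h)).1 i := fun h i => by simp [W]
  have hW2 : ∀ h : Fin H, W h a = (w' (e h)).2 := fun h => by simp [W]
  have hW3 : ∀ (h : Fin H) (o : Fin b), W h (a + 1 + o) = if o = (e h).1 then c' (e h) else 0 := by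
    intro h o
    have h1 : ¬ a + 1 + (o : ℕ) < a := by omega
    have h2 : a + 1 + (o : ℕ) ≠ a := by omega
    simp [W, h1, h2, Fin.ext_iff]
  refine ⟨H * (a + 1 + b), fun k hk => ⟨WithLp.toLp 2 fun i : Fin k =>
    W (i / (a + 1 + b)) (i % (a + 1 + b)), fun x => ?_⟩⟩
  have hkH : H ≤ k / (a + 1 + b) := (Nat.le_div_iff_mul_le (by omega)).2 hk
  ext o
  have h2 : ∀ h ∈ Finset.range (k / (a + 1 + b)),
      coord (WithLp.toLp 2 fun i : Fin k => W (i / (a + 1 + b)) (i % (a + 1 + b)))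
          (h * (a + 1 + b) + (a + 1) + o) *
        σ (∑ i : Fin a, coord (WithLp.toLp 2 fun i : Fin k =>
            W (i / (a + 1 + b)) (i % (a + 1 + b))) (h * (a + 1 + b) + i) * x i +
          coord (WithLp.toLp 2 fun i : Fin k => W (i / (a + 1 + b)) (i % (a + 1 + b)))
            (h * (a + 1 + b) + a)) =
      W h (a + 1 + o) * σ (∑ i : Fin a, W h i * x i + W h a) := by
    intro h hh
    have hh' := Finset.mem_range.1 hh
    have hc : ∀ r < a + 1 + b, coord (WithLp.toLp 2 fun i : Fin k =>
        W (i / (a + 1 + b)) (i % (a + 1 + b))) (h * (a + 1 + b) + r) = W h r :=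
      fun r hr => coord_mk W hh' hr
    rw [add_assoc (h * (a + 1 + b)), hc _ (by omega), hc _ (by omega)]
    congr 3
    exact Finset.sum_congr rfl fun i _ => by rw [hc _ (by omega)]
  simp only [net]
  -- Units beyond the first `H` have zero weights in `W` and drop out, so spare parameters do no
  -- harm.
  rw [Finset.sum_congr rfl h2, ← Finset.sum_subset (Finset.range_mono hkH), Finset.sum_range]
  · simp only [hW1, hW2, hW3]
    rw [e.sum_comp fun p => (if o = p.1 then c' p else 0) *
      σ (∑ i, (w' p).1 i * x i + (w' p).2), hw, Fintype.sum_sigma, Finset.sum_eq_single o]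
    · refine Finset.sum_congr rfl fun i _ => ?_
      simp [c', w']
    · intro o' _ ho'
      refine Finset.sum_eq_zero fun i _ => ?_
      simp [ho'.symm]
    · simp
  · intro h _ hh
    rw [Finset.mem_range] at hh
    simp [W, hh]

/-! ### Transport of non-atomic laws -/

/-- The probability integral transform: a non-atomic law on a standard Borel space has a uniform
image on the unit interval. -/
lemma exists_measurable_map_eq_volume {α : Type*} [MeasurableSpace α] [StandardBorelSpace α]
    (μ : Measure α) [IsProbabilityMeasure μ] [NullSingletonClass μ] :
    ∃ F : α → unitInterval, Measurable F ∧ μ.map F = volume := by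
  obtain ⟨e, he⟩ := exists_measurableEmbedding_real α
  set ν := μ.map e with hν
  have : IsProbabilityMeasure ν := Measure.isProbabilityMeasure_map he.measurable.aemeasurable
  have hatom : ∀ x, ν {x} = 0 := by
    intro x
    rw [hν, he.map_apply]
    have : (e ⁻¹' {x}).Subsingleton := fun a ha b hb => he.injective (ha.trans hb.symm)
    exact this.measure_zero μ
  -- The jump of the distribution function at `x` is the mass of `{x}`, which is zero.
  have hcont : Continuous (cdf ν) := by
    refine continuous_iff_continuousAt.2 fun x => ?_
    refine (monotone_cdf ν).continuousAt_iff_leftLim_eq_rightLim.2 ?_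
    have h1 : ENNReal.ofReal (cdf ν x - Function.leftLim (cdf ν) x) = 0 := by
      rw [← StieltjesFunction.measure_singleton, measure_cdf, hatom]
    have h2 := ENNReal.ofReal_eq_zero.1 h1
    rw [(cdf ν).rightLim_eq]
    exact le_antisymm ((monotone_cdf ν).leftLim_le le_rfl) (by linarith)
  have hivt : ∀ u ∈ Set.Ioo (0 : ℝ) 1, ∃ x, cdf ν x = u := fun u hu =>
    mem_range_of_exists_le_of_exists_ge hcont
      (((tendsto_cdf_atBot ν).eventually_lt_const hu.1).exists.imp fun _ h => h.le)
      (((tendsto_cdf_atTop ν).eventually_const_lt hu.2).exists.imp fun _ h => h.le)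
  have hmeas : Measurable (cdf ν) := hcont.measurable
  let G : ℝ → unitInterval := fun x => ⟨cdf ν x, cdf_nonneg ν x, cdf_le_one ν x⟩
  have hG : Measurable G := hmeas.subtype_mk
  have hle : ∀ u ∈ Set.Ioo (0 : ℝ) 1, ν {x | cdf ν x < u} ≤ ENNReal.ofReal u := by
    intro u hu
    obtain ⟨x, rfl⟩ := hivt u hu
    rw [ofReal_cdf]
    exact measure_mono fun y hy => ((monotone_cdf ν).reflect_lt hy).le
  have hge : ∀ u ∈ Set.Ioo (0 : ℝ) 1, ENNReal.ofReal u ≤ ν {x | cdf ν x ≤ u} := by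
    intro u hu
    obtain ⟨x, rfl⟩ := hivt u hu
    rw [ofReal_cdf]
    exact measure_mono fun y hy => monotone_cdf ν hy
  have hmap : ν.map G = volume := by
    refine Measure.ext_of_Iic _ _ fun u => ?_
    rw [Measure.map_apply hG measurableSet_Iic, unitInterval.volume_Iic]
    have hset : G ⁻¹' Set.Iic u = {x | cdf ν x ≤ u} := rfl
    rw [hset]
    rcases eq_or_lt_of_le u.2.2 with h1 | h1
    · have : {x | cdf ν x ≤ u} = Set.univ := Set.eq_univ_of_forall fun x => by
        simp only [Set.mem_ofPred_eq, h1]; exact cdf_le_one ν x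
      rw [this, measure_univ, h1, ENNReal.ofReal_one]
    refine le_antisymm ?_ ?_
    · have h2 : Tendsto (fun v : ℝ => ENNReal.ofReal v) (𝓝[>] (u : ℝ)) (𝓝 (ENNReal.ofReal u)) :=
        (ENNReal.continuous_ofReal.tendsto _).mono_left nhdsWithin_le_nhds
      refine ge_of_tendsto h2 ?_
      filter_upwards [Ioo_mem_nhdsGT h1] with v hv
      exact (measure_mono fun x hx => lt_of_le_of_lt hx hv.1).trans
        (hle v ⟨u.2.1.trans_lt hv.1, hv.2⟩)
    · rcases eq_or_lt_of_le u.2.1 with h0 | h0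
      · simp [← h0]
      · exact hge u ⟨h0, h1⟩
  exact ⟨G ∘ e, hG.comp he.measurable, by rw [← Measure.map_map hG he.measurable, hmap]⟩

/-- A non-atomic law on a standard Borel space can be transported to any law on a standard Borel
space. -/
lemma exists_measurable_transport {α β : Type*} [MeasurableSpace α] [StandardBorelSpace α]
    [MeasurableSpace β] [StandardBorelSpace β] (μ : Measure α) [IsProbabilityMeasure μ]
    [NullSingletonClass μ] (ν : Measure β) [IsProbabilityMeasure ν] :
    ∃ T : α → β, Measurable T ∧ μ.map T = ν := by
  obtain ⟨F, hF, hF'⟩ := exists_measurable_map_eq_volume μ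
  have : Nonempty β := nonempty_of_isProbabilityMeasure ν
  obtain ⟨f, hf, hf'⟩ := ν.exists_measurable_map_eq
  exact ⟨f ∘ F, hf.comp hF, by rw [← Measure.map_map hf hF, hF', hf']⟩

open InformationTheory

/-! ### The Gibbs variational principle -/

/-- `exp (-a)` for an extended nonnegative number `a`. -/
noncomputable def expNeg (a : ℝ≥0∞) : ℝ := if a = ∞ then 0 else Real.exp (-a.toReal)

lemma expNeg_top : expNeg ∞ = 0 := by simp [expNeg]

lemma expNeg_of_ne_top {a : ℝ≥0∞} (ha : a ≠ ∞) : expNeg a = Real.exp (-a.toReal) := by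
  simp [expNeg, ha]

lemma expNeg_nonneg (a : ℝ≥0∞) : 0 ≤ expNeg a := by
  unfold expNeg; split_ifs <;> positivity

lemma expNeg_pos {a : ℝ≥0∞} (ha : a ≠ ∞) : 0 < expNeg a := by
  rw [expNeg_of_ne_top ha]; positivity

lemma expNeg_le_one (a : ℝ≥0∞) : expNeg a ≤ 1 := by
  unfold expNeg
  split_ifs
  · exact zero_le_one
  · exact Real.exp_le_one_iff.2 (neg_nonpos.2 ENNReal.toReal_nonneg)

lemma measurable_expNeg : Measurable expNeg :=
  Measurable.ite (measurableSet_singleton ∞) measurable_const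
    (Real.measurable_exp.comp ENNReal.measurable_toReal.neg)

/-- The rate of a Gibbs law with density proportional to `u` with respect to `Q`. -/
noncomputable def gibbsRate {β : Type*} [MeasurableSpace β] (Q : Measure β) (u : β → ℝ) : ℝ :=
  -Real.log (∫ y, u y ∂Q) + (∫ y, u y * Real.log (u y) ∂Q) / ∫ y, u y ∂Q

/-- The product of the marginals is the closest product law, when one marginal is prescribed. -/
lemma klDiv_prod_snd_le {α β : Type*} [MeasurableSpace α] [StandardBorelSpace α] [Nonempty α]
    [MeasurableSpace β] (N : Measure (α × β)) [IsProbabilityMeasure N] (μ : Measure α)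
    [IsProbabilityMeasure μ] (Q : Measure β) [IsProbabilityMeasure Q] :
    klDiv N (μ.prod N.snd) ≤ klDiv N (μ.prod Q) := by
  have hsnd : (N.map Prod.swap).fst = N.snd := Measure.fst_map_swap
  have : IsProbabilityMeasure (N.map Prod.swap) :=
    Measure.isProbabilityMeasure_map measurable_swap.aemeasurable
  have hdis : N.snd ⊗ₘ (N.map Prod.swap).condKernel = N.map Prod.swap := by
    rw [← hsnd]; exact Measure.disintegrate _ _
  have h1 : klDiv (N.map Prod.swap) (Q.prod μ) ≤ klDiv N (μ.prod Q) := by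
    rw [← Measure.prod_swap]; exact klDiv_map_le _ _ measurable_swap
  have h2 : klDiv N (μ.prod N.snd) ≤ klDiv (N.map Prod.swap) (N.snd.prod μ) := by
    have := klDiv_map_le (N.map Prod.swap) (N.snd.prod μ) measurable_swap
    rwa [Measure.prod_swap, Measure.map_map measurable_swap measurable_swap, Prod.swap_swap_eq,
      Measure.map_id] at this
  refine h2.trans (le_trans ?_ h1)
  -- The chain rule splits off the first marginal, hence the swap. The discarded term is the
  -- divergence of `N.snd` from `Q`.
  have h3 := klDiv_compProd_eq_add N.snd Q (N.map Prod.swap).condKernel (Kernel.const β μ)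
  rw [hdis, Measure.compProd_const, Measure.compProd_const] at h3
  rw [h3]
  exact le_add_self

/-! ### Change of reference measure to a Gibbs law -/

section Density

variable {W : Type*}

/-- The normalized Gibbs density, where `ζ` is the normalizing factor. -/
noncomputable def gibbsDensity (e : W → ℝ≥0∞) (ζ : W → ℝ) (w : W) : ℝ :=
  if ζ w = 0 then 1 else expNeg (e w) / ζ w

variable {e : W → ℝ≥0∞} {ζ : W → ℝ}

lemma measurable_gibbsDensity [MeasurableSpace W] (he : Measurable e) (hζ : Measurable ζ) :
    Measurable (gibbsDensity e ζ) :=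
  Measurable.ite (hζ (measurableSet_singleton 0)) measurable_const
    ((measurable_expNeg.comp he).div hζ)

lemma gibbsDensity_nonneg (hζ0 : ∀ w, 0 ≤ ζ w) (w : W) : 0 ≤ gibbsDensity e ζ w := by
  unfold gibbsDensity
  split_ifs
  · exact zero_le_one
  · exact div_nonneg (expNeg_nonneg _) (hζ0 w)

lemma gibbsDensity_pos {w : W} (h : 0 < ζ w) (he : e w ≠ ∞) : 0 < gibbsDensity e ζ w := by
  rw [gibbsDensity, if_neg h.ne']
  exact div_pos (expNeg_pos he) h

lemma log_gibbsDensity {w : W} (h : 0 < ζ w) (he : e w ≠ ∞) :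
    Real.log (gibbsDensity e ζ w) = -(e w).toReal - Real.log (ζ w) := by
  rw [gibbsDensity, if_neg h.ne', Real.log_div (expNeg_pos he).ne' h.ne', expNeg_of_ne_top he,
    Real.log_exp]

variable [MeasurableSpace W] {M M0 : Measure W}

lemma absolutelyContinuous_gibbs (he : Measurable e) (hζ : Measurable ζ) (hM : M ≪ M0)
    (hpos : ∀ᵐ w ∂M, 0 < ζ w) (hfin : ∀ᵐ w ∂M, e w ≠ ∞) :
    M ≪ M0.withDensity fun w => ENNReal.ofReal (gibbsDensity e ζ w) := by
  have hm := (measurable_gibbsDensity he hζ).ennreal_ofReal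
  intro A hA
  have h1 : ∀ᵐ w ∂M0, w ∈ A → ENNReal.ofReal (gibbsDensity e ζ w) = 0 := by
    have := (withDensity_apply_eq_zero hm).1 hA
    have h2 : ∀ᵐ w ∂M0, w ∉ {x | ENNReal.ofReal (gibbsDensity e ζ x) ≠ 0} ∩ A :=
      measure_eq_zero_iff_ae_notMem.1 this
    filter_upwards [h2] with w hw hwA
    by_contra h
    exact hw ⟨h, hwA⟩
  rw [measure_eq_zero_iff_ae_notMem]
  filter_upwards [hM.ae_le h1, hpos, hfin] with w h1 h2 h3 hw
  exact absurd (h1 hw) (ENNReal.ofReal_pos.2 (gibbsDensity_pos h2 h3)).ne'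

lemma ae_gibbs_ne_top (he : Measurable e) (hζ : Measurable ζ)
    (hpos : ∀ᵐ w ∂(M0.withDensity fun w => ENNReal.ofReal (gibbsDensity e ζ w)), 0 < ζ w) :
    ∀ᵐ w ∂(M0.withDensity fun w => ENNReal.ofReal (gibbsDensity e ζ w)), e w ≠ ∞ := by
  have hm := (measurable_gibbsDensity he hζ).ennreal_ofReal
  filter_upwards [hpos, (ae_withDensity_iff hm).2 (Eventually.of_forall fun w h => h)] with w h1 h2 h3
  refine h2 ?_
  rw [gibbsDensity, if_neg h1.ne', h3, expNeg_top, zero_div, ENNReal.ofReal_zero]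

variable [IsProbabilityMeasure M] [IsProbabilityMeasure M0]

/-- Chain rule for densities: with `N` the Gibbs law, `dM/dM0 = dM/dN · dN/dM0`, and the last factor
is explicit. -/
lemma llr_gibbs (he : Measurable e) (hζ : Measurable ζ) (hM : M ≪ M0)
    (hpos : ∀ᵐ w ∂M, 0 < ζ w) (hfin : ∀ᵐ w ∂M, e w ≠ ∞) :
    llr M M0 =ᵐ[M] fun w =>
      llr M (M0.withDensity fun w => ENNReal.ofReal (gibbsDensity e ζ w)) w +
        (-(e w).toReal - Real.log (ζ w)) := by
  have hm := (measurable_gibbsDensity he hζ).ennreal_ofReal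
  have hMN := absolutelyContinuous_gibbs he hζ hM hpos hfin
  filter_upwards [hM.ae_le (Measure.rnDeriv_mul_rnDeriv (κ := M0) hMN),
    hM.ae_le (Measure.rnDeriv_withDensity M0 hm), Measure.rnDeriv_pos hMN,
    hMN.ae_le (Measure.rnDeriv_lt_top M _), hpos, hfin] with w h1 h2 h3 h4 h5 h6
  have h7 := gibbsDensity_pos h5 h6
  rw [llr, llr, ← log_gibbsDensity h5 h6, ← h1, Pi.mul_apply, h2, ENNReal.toReal_mul,
    ENNReal.toReal_ofReal h7.le, Real.log_mul (ENNReal.toReal_pos h3.ne' h4.ne).ne' h7.ne']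

variable [IsProbabilityMeasure (M0.withDensity fun w => ENNReal.ofReal (gibbsDensity e ζ w))]

/-- With `N` the Gibbs law, `-log ζ = llr M M0 + e + log (dN/dM)` and `log t ≤ t`. Since `ζ ≤ 1`
makes the left side nonnegative, it is dominated by `llr M M0 + e + dN/dM`, which is integrable. -/
lemma integrable_gibbs (he : Measurable e) (hζ : Measurable ζ) (hζ1 : ∀ w, ζ w ≤ 1) (hM : M ≪ M0)
    (hpos : ∀ᵐ w ∂M, 0 < ζ w) (hfin : ∀ᵐ w ∂M, e w ≠ ∞)
    (hllr : Integrable (llr M M0) M) (hei : Integrable (fun w => (e w).toReal) M) :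
    Integrable (fun w => Real.log (ζ w)) M ∧
      Integrable (llr M (M0.withDensity fun w => ENNReal.ofReal (gibbsDensity e ζ w))) M := by
  have hMN := absolutelyContinuous_gibbs he hζ hM hpos hfin
  have h1 : Integrable (fun w => Real.log (ζ w)) M := by
    refine (hllr.add (hei.add (Measure.integrable_toReal_rnDeriv
      (μ := M0.withDensity fun w => ENNReal.ofReal (gibbsDensity e ζ w)) (ν := M)))).mono'
      (Real.measurable_log.comp hζ).aestronglyMeasurable ?_
    filter_upwards [llr_gibbs he hζ hM hpos hfin, neg_llr hMN, hpos] with w h2 h3 h4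
    rw [Real.norm_eq_abs, abs_of_nonpos (Real.log_nonpos h4.le (hζ1 w))]
    have h5 := Real.log_le_self (x := ((M0.withDensity fun w =>
      ENNReal.ofReal (gibbsDensity e ζ w)).rnDeriv M w).toReal) ENNReal.toReal_nonneg
    simp only [Pi.neg_apply] at h3
    rw [llr_def] at h3
    simp only [Pi.add_apply]
    change _ = Real.log ((M0.withDensity fun w =>
      ENNReal.ofReal (gibbsDensity e ζ w)).rnDeriv M w).toReal at h3
    simp only [llr] at h2 ⊢
    linarith
  refine ⟨h1, ((hllr.add hei).add h1).congr ?_⟩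
  filter_upwards [llr_gibbs he hζ hM hpos hfin] with w h2
  simp only [Pi.add_apply, h2]
  ring

/-- On the Gibbs law the log-likelihood ratio is `-e - log ζ`, so `e` cancels in the sum.
Integrability of `e` again comes from `log t ≤ t`, applied to the inverse density. -/
lemma gibbs_value (he : Measurable e) (hζ : Measurable ζ)
    (hpos : ∀ᵐ w ∂(M0.withDensity fun w => ENNReal.ofReal (gibbsDensity e ζ w)), 0 < ζ w)
    (hlog : Integrable (fun w => Real.log (ζ w))
      (M0.withDensity fun w => ENNReal.ofReal (gibbsDensity e ζ w))) :
    klDiv (M0.withDensity fun w => ENNReal.ofReal (gibbsDensity e ζ w)) M0 +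
        ∫⁻ w, e w ∂(M0.withDensity fun w => ENNReal.ofReal (gibbsDensity e ζ w)) =
      ENNReal.ofReal (∫ w, -Real.log (ζ w)
        ∂(M0.withDensity fun w => ENNReal.ofReal (gibbsDensity e ζ w))) := by
  have hfin := ae_gibbs_ne_top he hζ hpos
  set N := M0.withDensity fun w => ENNReal.ofReal (gibbsDensity e ζ w) with hN
  have hac : N ≪ M0 := withDensity_absolutelyContinuous _ _
  have hllr : llr N M0 =ᵐ[N] fun w => -(e w).toReal - Real.log (ζ w) := by
    filter_upwards [llr_gibbs (M := N) he hζ hac hpos hfin, llr_self N] with w h1 h2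
    rw [h1, ← hN, h2, Pi.zero_apply, zero_add]
  have hei : Integrable (fun w => (e w).toReal) N := by
    refine ((Measure.integrable_toReal_rnDeriv (μ := M0) (ν := N)).sub hlog).mono'
      he.ennreal_toReal.aestronglyMeasurable ?_
    filter_upwards [hllr, neg_llr hac] with w h1 h2
    rw [Real.norm_eq_abs, abs_of_nonneg ENNReal.toReal_nonneg]
    have h3 := Real.log_le_self (x := (M0.rnDeriv N w).toReal) ENNReal.toReal_nonneg
    rw [Pi.neg_apply, h1] at h2
    simp only [llr, Pi.sub_apply] at h2 ⊢
    linarith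
  have hi : Integrable (llr N M0) N := (hei.neg.sub hlog).congr hllr.symm
  have h1 : ∫⁻ w, e w ∂N = ENNReal.ofReal (∫ w, (e w).toReal ∂N) := by
    rw [ofReal_integral_eq_lintegral_ofReal hei (Eventually.of_forall fun _ => ENNReal.toReal_nonneg)]
    refine lintegral_congr_ae ?_
    filter_upwards [hfin] with w hw
    rw [ENNReal.ofReal_toReal hw]
  have h2 : 0 ≤ ∫ w, llr N M0 w ∂N := by
    simpa using integral_llr_add_sub_measure_univ_nonneg hac hi
  rw [klDiv_of_ac_of_integrable hac hi, h1]
  simp only [probReal_univ, add_sub_cancel_right]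
  rw [← ENNReal.ofReal_add h2 (integral_nonneg fun _ => ENNReal.toReal_nonneg),
    ← integral_add hi hei]
  congr 1
  refine integral_congr_ae ?_
  filter_upwards [hllr] with w hw
  rw [hw]; ring

end Density

/-- **The optimal test channel is a Gibbs channel**: a minimizer `κ` of the Lagrangian with
reproduction law `Q` has a normalizing factor whose logarithm is integrable, and its mutual
information is the mean of the rates of the Gibbs laws. -/
theorem optimal_channel_gibbs {α β : Type*} [MeasurableSpace α] [StandardBorelSpace α]
    [Nonempty α] [MeasurableSpace β] (μ : Measure α) [IsProbabilityMeasure μ] (κ : Kernel α β)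
    [IsMarkovKernel κ] (e : α × β → ℝ≥0∞) (he : Measurable e)
    (hfin : klDiv (μ ⊗ₘ κ) (μ.prod (κ ∘ₘ μ)) + ∫⁻ w, e w ∂(μ ⊗ₘ κ) ≠ ∞)
    (hmin : ∀ κ' : Kernel α β, IsMarkovKernel κ' →
      klDiv (μ ⊗ₘ κ) (μ.prod (κ ∘ₘ μ)) + ∫⁻ w, e w ∂(μ ⊗ₘ κ) ≤
        klDiv (μ ⊗ₘ κ') (μ.prod (κ' ∘ₘ μ)) + ∫⁻ w, e w ∂(μ ⊗ₘ κ')) :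
    (∀ᵐ x ∂μ, 0 < ∫ y, expNeg (e (x, y)) ∂(κ ∘ₘ μ)) ∧
    Integrable (fun x => Real.log (∫ y, expNeg (e (x, y)) ∂(κ ∘ₘ μ))) μ ∧
    (klDiv (μ ⊗ₘ κ) (μ.prod (κ ∘ₘ μ))).toReal =
      ∫ x, gibbsRate (κ ∘ₘ μ) (fun y => expNeg (e (x, y))) ∂μ := by
  set Q := κ ∘ₘ μ with hQ
  set M := μ ⊗ₘ κ with hMdef
  set M0 := μ.prod Q with hM0
  have hMfst : M.fst = μ := Measure.fst_compProd _ _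
  have hu : Measurable fun w => expNeg (e w) := measurable_expNeg.comp he
  have hui : ∀ x, Integrable (fun y => expNeg (e (x, y))) Q := fun x =>
    Integrable.of_bound (hu.comp measurable_prodMk_left).aestronglyMeasurable 1
      (Eventually.of_forall fun y => by
        rw [Real.norm_eq_abs, abs_of_nonneg (expNeg_nonneg _)]; exact expNeg_le_one _)
  set Z : α → ℝ := fun x => ∫ y, expNeg (e (x, y)) ∂Q with hZ
  have hZm : Measurable Z := (hu.stronglyMeasurable.integral_prod_right (ν := Q)).measurable
  have hZ0 : ∀ x, 0 ≤ Z x := fun x => integral_nonneg fun y => expNeg_nonneg _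
  have hZ1 : ∀ x, Z x ≤ 1 := fun x => by
    have := integral_mono (hui x) (integrable_const (1 : ℝ)) fun y => expNeg_le_one _
    simpa using this
  let ζ : α × β → ℝ := fun w => Z w.1
  have hζ : Measurable ζ := hZm.comp measurable_fst
  have hI : klDiv M M0 ≠ ∞ := fun h => hfin (by rw [h, top_add])
  have hE : ∫⁻ w, e w ∂M ≠ ∞ := fun h => hfin (by rw [h, add_top])
  obtain ⟨hac, hllr⟩ := klDiv_ne_top_iff.1 hI
  have hefin : ∀ᵐ w ∂M, e w ≠ ∞ := (ae_lt_top he hE).mono fun w h => h.ne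
  have hei : Integrable (fun w => (e w).toReal) M :=
    integrable_toReal_of_lintegral_ne_top he.aemeasurable hE
  -- Where `Z x = 0` the distortion is infinite `Q`-almost everywhere, which absolute continuity and
  -- the finite mean distortion exclude under `M`.
  have hpos : ∀ᵐ w ∂M, 0 < ζ w := by
    have h1 : ∀ᵐ w ∂M0, ζ w = 0 → e w = ∞ := by
      rw [Measure.ae_prod_iff_ae_ae]
      · refine Eventually.of_forall fun x => ?_
        by_cases hx : Z x = 0
        · have h2 := (integral_eq_zero_iff_of_nonneg (fun y => expNeg_nonneg _) (hui x)).1 hx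
          filter_upwards [h2] with y hy _
          by_contra h
          exact (expNeg_pos h).ne' hy
        · exact Eventually.of_forall fun y h => absurd h hx
      · exact (hζ (measurableSet_singleton 0)).imp (he (measurableSet_singleton ∞))
    filter_upwards [hac.ae_le h1, hefin] with w h2 h3
    exact lt_of_le_of_ne (hZ0 _) fun h => h3 (h2 h.symm)
  have hposμ : ∀ᵐ x ∂μ, 0 < Z x := by
    rw [← hMfst, Measure.fst]
    exact (ae_map_iff measurable_fst.aemeasurable (measurableSet_lt measurable_const hZm)).2 hpos
  -- the Gibbs channel
  have hd : Measurable (gibbsDensity e ζ) := measurable_gibbsDensity he hζ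
  let κ' : Kernel α β := (Kernel.const α Q).withDensity
    fun x y => ENNReal.ofReal (gibbsDensity e ζ (x, y))
  have hκ'a : ∀ x, κ' x = Q.withDensity fun y => ENNReal.ofReal (gibbsDensity e ζ (x, y)) :=
    fun x => by rw [Kernel.withDensity_apply _ hd.ennreal_ofReal, Kernel.const_apply]
  have hκ' : IsMarkovKernel κ' := by
    refine ⟨fun x => ⟨?_⟩⟩
    rw [hκ'a, withDensity_apply _ MeasurableSet.univ, Measure.restrict_univ]
    -- Where `Z x = 0` the default density 1 makes `κ' x = Q`, so the kernel is Markov everywhere.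
    by_cases hx : Z x = 0
    · simp [gibbsDensity, ζ, hx]
    · have h1 : ∀ y, gibbsDensity e ζ (x, y) = expNeg (e (x, y)) / Z x := fun y => by
        simp [gibbsDensity, ζ, hx]
      simp only [h1]
      rw [← ofReal_integral_eq_lintegral_ofReal ((hui x).div_const _)
        (Eventually.of_forall fun y => div_nonneg (expNeg_nonneg _) (hZ0 x)), integral_div,
        div_self hx, ENNReal.ofReal_one]
  have hN : μ ⊗ₘ κ' = M0.withDensity fun w => ENNReal.ofReal (gibbsDensity e ζ w) := by
    rw [hM0, ← Measure.compProd_const]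
    exact Measure.compProd_withDensity hd.ennreal_ofReal
  have hNP : IsProbabilityMeasure (M0.withDensity fun w => ENNReal.ofReal (gibbsDensity e ζ w)) := by
    rw [← hN]; infer_instance
  obtain ⟨hlog, hllrN⟩ := integrable_gibbs he hζ (fun w => hZ1 _) hac hpos hefin hllr hei
  have hlogμ : Integrable (fun x => Real.log (Z x)) μ := by
    rw [← hMfst, Measure.fst]
    exact (integrable_map_measure (Real.measurable_log.comp hZm).aestronglyMeasurable
      measurable_fst.aemeasurable).2 hlog
  have hNfst : (μ ⊗ₘ κ').fst = μ := Measure.fst_compProd _ _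
  have hposN : ∀ᵐ w ∂(μ ⊗ₘ κ'), 0 < ζ w := by
    rw [← hNfst, Measure.fst] at hposμ
    exact ae_of_ae_map measurable_fst.aemeasurable hposμ
  have hlogN : Integrable (fun w => Real.log (ζ w)) (μ ⊗ₘ κ') := by
    rw [← hNfst, Measure.fst] at hlogμ
    exact hlogμ.comp_measurable measurable_fst
  have hval : ∀ ν : Measure (α × β), ν.fst = μ →
      ∫ w, Real.log (ζ w) ∂ν = ∫ x, Real.log (Z x) ∂μ := by
    intro ν hν
    rw [← hν, Measure.fst]
    exact (integral_map measurable_fst.aemeasurable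
      (Real.measurable_log.comp hZm).aestronglyMeasurable).symm
  -- The Gibbs channel has its own reproduction law, in general not `Q`; replacing that law by `Q`
  -- only increases the divergence.
  have hup : klDiv (μ ⊗ₘ κ') (μ.prod (κ' ∘ₘ μ)) + ∫⁻ w, e w ∂(μ ⊗ₘ κ') ≤
      ENNReal.ofReal (-∫ x, Real.log (Z x) ∂μ) := by
    have h1 := klDiv_prod_snd_le (μ ⊗ₘ κ') μ Q
    rw [Measure.snd_compProd] at h1
    refine (add_le_add_left h1 _).trans (le_of_eq ?_)
    rw [← hval _ hNfst, ← integral_neg]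
    rw [hN] at hposN hlogN ⊢
    exact gibbs_value he hζ hposN hlogN
  have hlow : klDiv M M0 + ∫⁻ w, e w ∂M =
      ENNReal.ofReal (∫ w, llr M (M0.withDensity fun w =>
        ENNReal.ofReal (gibbsDensity e ζ w)) w ∂M - ∫ x, Real.log (Z x) ∂μ) := by
    have h1 : ∫⁻ w, e w ∂M = ENNReal.ofReal (∫ w, (e w).toReal ∂M) := by
      rw [integral_toReal he.aemeasurable (ae_lt_top he hE), ENNReal.ofReal_toReal hE]
    have h2 : 0 ≤ ∫ w, llr M M0 w ∂M := by
      simpa using integral_llr_add_sub_measure_univ_nonneg hac hllr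
    rw [klDiv_of_ac_of_integrable hac hllr, h1]
    simp only [probReal_univ, add_sub_cancel_right]
    rw [← ENNReal.ofReal_add h2 (integral_nonneg fun _ => ENNReal.toReal_nonneg),
      ← integral_add hllr hei, ← hval M hMfst, ← integral_sub hllrN hlog]
    congr 1
    refine integral_congr_ae ?_
    filter_upwards [llr_gibbs he hζ hac hpos hefin] with w hw
    rw [hw]; ring
  have hle := (hmin κ' hκ').trans hup
  rw [hlow] at hle
  have hnonneg : 0 ≤ -∫ x, Real.log (Z x) ∂μ := by
    rw [← integral_neg]
    refine integral_nonneg fun x => ?_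
    exact neg_nonneg.2 (Real.log_nonpos (hZ0 x) (hZ1 x))
  rw [ENNReal.ofReal_le_ofReal_iff hnonneg] at hle
  -- Comparing the two values leaves `KL(M ‖ N) ≤ 0`.
  have hMN : M = M0.withDensity fun w => ENNReal.ofReal (gibbsDensity e ζ w) := by
    rw [← klDiv_eq_zero_iff, klDiv_of_ac_of_integrable
      (absolutelyContinuous_gibbs he hζ hac hpos hefin) hllrN]
    simp only [probReal_univ, add_sub_cancel_right]
    exact ENNReal.ofReal_eq_zero.2 (by linarith)
  refine ⟨hposμ, hlogμ, ?_⟩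
  have hllrM : llr M M0 =ᵐ[M] fun w => -(e w).toReal - Real.log (ζ w) := by
    filter_upwards [llr_gibbs he hζ hac hpos hefin, llr_self M] with w h1 h2
    rw [h1, ← hMN, h2, Pi.zero_apply, zero_add]
  have h1 : Integrable (fun w => (ENNReal.ofReal (gibbsDensity e ζ w)).toReal • (e w).toReal)
      (μ.prod Q) := by
    rw [← integrable_withDensity_iff_integrable_smul' hd.ennreal_ofReal
      (Eventually.of_forall fun _ => ENNReal.ofReal_lt_top), ← hM0, ← hMN]
    exact hei
  have h2 : (fun x => ∫ y, (ENNReal.ofReal (gibbsDensity e ζ (x, y))).toReal •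
      (e (x, y)).toReal ∂Q) =ᵐ[μ] fun x =>
        -((∫ y, expNeg (e (x, y)) * Real.log (expNeg (e (x, y))) ∂Q) / Z x) := by
    filter_upwards [hposμ] with x hx
    rw [← integral_div, ← integral_neg]
    refine integral_congr_ae (Eventually.of_forall fun y => ?_)
    simp only
    rw [ENNReal.toReal_ofReal (gibbsDensity_nonneg (fun w => hZ0 _) _), gibbsDensity,
      if_neg (show ζ (x, y) ≠ 0 from hx.ne')]
    -- Where `e = ∞` the weight is 0 and both sides vanish, by `0 * log 0 = 0`.
    by_cases hxy : e (x, y) = ∞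
    · simp [hxy, expNeg_top]
    · rw [expNeg_of_ne_top hxy, Real.log_exp, smul_eq_mul]
      ring
  have hEI : ∫ w, (e w).toReal ∂M =
      -∫ x, (∫ y, expNeg (e (x, y)) * Real.log (expNeg (e (x, y))) ∂Q) / Z x ∂μ := by
    rw [hMN, integral_withDensity_eq_integral_toReal_smul hd.ennreal_ofReal
      (Eventually.of_forall fun _ => ENNReal.ofReal_lt_top), hM0, integral_prod _ h1,
      integral_congr_ae h2, integral_neg]
  have hratio : Integrable
      (fun x => (∫ y, expNeg (e (x, y)) * Real.log (expNeg (e (x, y))) ∂Q) / Z x) μ :=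
    (h1.integral_prod_left.congr h2).neg.congr (Eventually.of_forall fun x => neg_neg _)
  have hsplit : ∫ w, (-(e w).toReal - Real.log (ζ w)) ∂M =
      -(∫ w, (e w).toReal ∂M) - ∫ w, Real.log (ζ w) ∂M := by
    rw [← integral_neg]; exact integral_sub hei.neg hlog
  rw [toReal_klDiv_of_measure_eq hac (by simp), integral_congr_ae hllrM, hsplit, hEI,
    hval M hMfst, neg_neg]
  simp only [gibbsRate]
  have hadd := integral_add hlogμ.neg hratio
  simp only [Pi.neg_apply, integral_neg] at hadd
  rw [hadd]
  ring

/-! ### Stability of the Gibbs rate -/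

section GibbsRate

variable {β : Type*} [MeasurableSpace β] {Q : Measure β} [IsProbabilityMeasure Q]

lemma exists_bound_mul_log (C : ℝ) : ∃ B, ∀ t, |t| ≤ C → |t * Real.log t| ≤ B := by
  obtain ⟨B, hB⟩ := (isCompact_Icc (a := -C) (b := C)).exists_bound_of_continuousOn
    Real.continuous_mul_log.continuousOn
  exact ⟨B, fun t ht => hB t (abs_le.1 ht)⟩

lemma integrable_mul_log {u : β → ℝ} (hu : AEStronglyMeasurable u Q) {C : ℝ}
    (hC : ∀ y, |u y| ≤ C) : Integrable (fun y => u y * Real.log (u y)) Q := by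
  obtain ⟨B, hB⟩ := exists_bound_mul_log C
  exact Integrable.of_bound (Real.continuous_mul_log.comp_aestronglyMeasurable hu) B
    (Eventually.of_forall fun y => hB _ (hC y))

/-- Jensen's inequality for `t log t`. If the mean of `u` is zero, the default values of `log` and
division give rate 0. -/
lemma gibbsRate_nonneg {u : β → ℝ} (hu : AEStronglyMeasurable u Q) (h0 : ∀ y, 0 ≤ u y) {C : ℝ}
    (hC : ∀ y, u y ≤ C) : 0 ≤ gibbsRate Q u := by
  have habs : ∀ y, |u y| ≤ C := fun y => by rw [abs_of_nonneg (h0 y)]; exact hC y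
  have hi : Integrable u Q := Integrable.of_bound hu C (Eventually.of_forall habs)
  have hJ := Real.convexOn_mul_log.map_integral_le Real.continuous_mul_log.continuousOn
    isClosed_Ici (Eventually.of_forall h0) hi (integrable_mul_log hu habs)
  rcases (integral_nonneg h0 : 0 ≤ ∫ y, u y ∂Q).eq_or_lt with h | h
  · simp [gibbsRate, ← h]
  · rw [gibbsRate, neg_add_eq_sub, sub_nonneg, le_div_iff₀ h, mul_comm]
    exact hJ

lemma gibbsRate_le {u : β → ℝ} (hu : AEStronglyMeasurable u Q) (h0 : ∀ y, 0 ≤ u y) {C : ℝ}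
    (hC : ∀ y, u y ≤ C) (hpos : 0 < ∫ y, u y ∂Q) :
    gibbsRate Q u ≤ Real.log C - Real.log (∫ y, u y ∂Q) := by
  have habs : ∀ y, |u y| ≤ C := fun y => by rw [abs_of_nonneg (h0 y)]; exact hC y
  have hi : Integrable u Q := Integrable.of_bound hu C (Eventually.of_forall habs)
  have h1 : ∫ y, u y * Real.log (u y) ∂Q ≤ Real.log C * ∫ y, u y ∂Q := by
    rw [← integral_const_mul]
    refine integral_mono (integrable_mul_log hu habs) (hi.const_mul _) fun y => ?_
    rcases (h0 y).eq_or_lt with h | h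
    · simp [← h]
    · simp only
      rw [mul_comm]
      exact mul_le_mul_of_nonneg_right (Real.log_le_log h (hC y)) h.le
  have h2 := (div_le_iff₀ hpos).2 h1
  rw [gibbsRate]
  linarith

/-- Dominated convergence in both integrals. Since `t log t` is continuous at 0, the limit weight
may vanish at points; only its mean must be positive. -/
lemma tendsto_gibbsRate {u : ℕ → β → ℝ} {v : β → ℝ} (hu : ∀ n, AEStronglyMeasurable (u n) Q)
    {C : ℝ} (hC : ∀ n y, |u n y| ≤ C) (hlim : ∀ᵐ y ∂Q, Tendsto (fun n => u n y) atTop (𝓝 (v y)))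
    (hpos : 0 < ∫ y, v y ∂Q) :
    Tendsto (fun n => gibbsRate Q (u n)) atTop (𝓝 (gibbsRate Q v)) := by
  obtain ⟨B, hB⟩ := exists_bound_mul_log C
  have h1 : Tendsto (fun n => ∫ y, u n y ∂Q) atTop (𝓝 (∫ y, v y ∂Q)) :=
    tendsto_integral_of_dominated_convergence (fun _ => C) hu (integrable_const _)
      (fun n => Eventually.of_forall (hC n)) hlim
  have h2 : Tendsto (fun n => ∫ y, u n y * Real.log (u n y) ∂Q) atTop
      (𝓝 (∫ y, v y * Real.log (v y) ∂Q)) := by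
    refine tendsto_integral_of_dominated_convergence (fun _ => B)
      (fun n => Real.continuous_mul_log.comp_aestronglyMeasurable (hu n)) (integrable_const _)
      (fun n => Eventually.of_forall fun y => hB _ (hC n y)) ?_
    filter_upwards [hlim] with y hy
    exact (Real.continuous_mul_log.tendsto _).comp hy
  exact ((h1.log hpos.ne').neg).add (h2.div h1 hpos.ne')

variable {α : Type*} [MeasurableSpace α] {μ : Measure α}

lemma measurable_gibbsRate {U : α → β → ℝ} (hU : Measurable (Function.uncurry U)) :
    Measurable fun x => gibbsRate Q (U x) := by
  have h1 : Measurable fun x => ∫ y, U x y ∂Q :=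
    (hU.stronglyMeasurable.integral_prod_right (ν := Q)).measurable
  have h2 : Measurable fun x => ∫ y, U x y * Real.log (U x y) ∂Q :=
    ((hU.mul (Real.measurable_log.comp hU)).stronglyMeasurable.integral_prod_right (ν := Q)).measurable
  exact (Real.measurable_log.comp h1).neg.add (h2.div h1)

lemma abs_gibbsRate_le {u : β → ℝ} (hu : AEStronglyMeasurable u Q) {c C : ℝ} (hc : 0 < c)
    (h : ∀ y, u y ∈ Set.Icc c C) : |gibbsRate Q u| ≤ Real.log C - Real.log c := by
  have h0 : ∀ y, 0 ≤ u y := fun y => hc.le.trans (h y).1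
  have hi : Integrable u Q := Integrable.of_bound hu C (Eventually.of_forall fun y => by
    rw [Real.norm_eq_abs, abs_of_nonneg (h0 y)]; exact (h y).2)
  have h1 : c ≤ ∫ y, u y ∂Q := by
    simpa using integral_mono (integrable_const c) hi fun y => (h y).1
  rw [abs_of_nonneg (gibbsRate_nonneg hu h0 fun y => (h y).2)]
  have h2 := gibbsRate_le hu h0 (fun y => (h y).2) (hc.trans_le h1)
  have h3 := Real.log_le_log hc h1
  linarith

/-- Dominated convergence for the mean Gibbs rate. -/
lemma tendsto_integral_gibbsRate [IsFiniteMeasure μ] {U : ℕ → α → β → ℝ} {V : α → β → ℝ}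
    (hU : ∀ n, Measurable (Function.uncurry (U n))) {c C : ℝ} (hc : 0 < c)
    (hb : ∀ n x y, U n x y ∈ Set.Icc c C)
    (hlim : ∀ᵐ x ∂μ, ∀ᵐ y ∂Q, Tendsto (fun n => U n x y) atTop (𝓝 (V x y))) :
    Tendsto (fun n => ∫ x, gibbsRate Q (U n x) ∂μ) atTop (𝓝 (∫ x, gibbsRate Q (V x) ∂μ)) := by
  have hm : ∀ n x, AEStronglyMeasurable (U n x) Q := fun n x =>
    ((hU n).comp measurable_prodMk_left).aestronglyMeasurable
  refine tendsto_integral_of_dominated_convergence (fun _ => Real.log C - Real.log c)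
    (fun n => (measurable_gibbsRate (hU n)).aestronglyMeasurable) (integrable_const _)
    (fun n => Eventually.of_forall fun x => abs_gibbsRate_le (hm n x) hc (hb n x)) ?_
  filter_upwards [hlim] with x hx
  have hVm : AEStronglyMeasurable (V x) Q := aestronglyMeasurable_of_tendsto_ae atTop (hm · x) hx
  have hVb : ∀ᵐ y ∂Q, V x y ∈ Set.Icc c C := by
    filter_upwards [hx] with y hy
    exact isClosed_Icc.mem_of_tendsto hy (Eventually.of_forall fun n => hb n x y)
  have hVi : Integrable (V x) Q := Integrable.of_bound hVm C (by
    filter_upwards [hVb] with y hy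
    rw [Real.norm_eq_abs, abs_of_nonneg (hc.le.trans hy.1)]; exact hy.2)
  refine tendsto_gibbsRate (hm · x) (C := C) (fun n y => ?_) hx ?_
  · rw [abs_of_nonneg (hc.le.trans (hb n x y).1)]; exact (hb n x y).2
  · refine hc.trans_le ?_
    simpa using integral_mono_ae (integrable_const c) hVi (hVb.mono fun y hy => hy.1)

/-- The mean Gibbs rate of a truncated distortion converges to the rate of the distortion. -/
lemma tendsto_integral_gibbsRate_truncate {lam : ℝ} (hlam : 0 < lam) (D : α × β → ℝ≥0∞)
    (hD : Measurable D)
    (hpos : ∀ᵐ x ∂μ, 0 < ∫ y, expNeg (ENNReal.ofReal lam * D (x, y)) ∂Q)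
    (hlog : Integrable (fun x => Real.log (∫ y, expNeg (ENNReal.ofReal lam * D (x, y)) ∂Q)) μ) :
    Tendsto (fun n : ℕ => ∫ x, gibbsRate Q
        (fun y => Real.exp (-lam * (min (D (x, y)) n).toReal)) ∂μ) atTop
      (𝓝 (∫ x, gibbsRate Q (fun y => expNeg (ENNReal.ofReal lam * D (x, y))) ∂μ)) := by
  have hm : ∀ n : ℕ, Measurable (Function.uncurry fun x y =>
      Real.exp (-lam * (min (D (x, y)) n).toReal)) := fun n =>
    Real.measurable_exp.comp ((hD.min measurable_const).ennreal_toReal.const_mul _)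
  have hm' : ∀ (n : ℕ) x, AEStronglyMeasurable
      (fun y => Real.exp (-lam * (min (D (x, y)) n).toReal)) Q := fun n x =>
    ((hm n).comp measurable_prodMk_left).aestronglyMeasurable
  have h1 : ∀ (n : ℕ) w, Real.exp (-lam * (min (D w) n).toReal) ≤ 1 := fun n w =>
    Real.exp_le_one_iff.2 (by
      have := mul_nonneg hlam.le (ENNReal.toReal_nonneg (a := min (D w) n)); linarith)
  have habs : ∀ (n : ℕ) w, |Real.exp (-lam * (min (D w) n).toReal)| ≤ 1 := fun n w => by
    rw [abs_of_pos (Real.exp_pos _)]; exact h1 n w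
  have hval : ∀ w, D w ≠ ∞ → expNeg (ENNReal.ofReal lam * D w) = Real.exp (-lam * (D w).toReal) := by
    intro w hw
    rw [expNeg_of_ne_top (ENNReal.mul_ne_top ENNReal.ofReal_ne_top hw), ENNReal.toReal_mul,
      ENNReal.toReal_ofReal hlam.le, neg_mul]
  have htop : ∀ w, D w = ∞ → expNeg (ENNReal.ofReal lam * D w) = 0 := by
    intro w hw
    rw [hw, ENNReal.mul_top (ENNReal.ofReal_pos.2 hlam).ne', expNeg_top]
  have hge : ∀ (n : ℕ) w, expNeg (ENNReal.ofReal lam * D w) ≤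
      Real.exp (-lam * (min (D w) n).toReal) := by
    intro n w
    by_cases hw : D w = ∞
    · rw [htop w hw]; positivity
    · rw [hval w hw, Real.exp_le_exp]
      have := ENNReal.toReal_mono hw (min_le_left (D w) n)
      nlinarith
  have hlim : ∀ w, Tendsto (fun n : ℕ => Real.exp (-lam * (min (D w) n).toReal)) atTop
      (𝓝 (expNeg (ENNReal.ofReal lam * D w))) := by
    intro w
    by_cases hw : D w = ∞
    · rw [htop w hw]
      simp only [hw, min_eq_right le_top, ENNReal.toReal_natCast]
      exact Real.tendsto_exp_atBot.comp
        (tendsto_natCast_atTop_atTop.const_mul_atTop_of_neg (neg_neg_of_pos hlam))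
    · rw [hval w hw]
      obtain ⟨N, hN⟩ := ENNReal.exists_nat_gt hw
      refine tendsto_const_nhds.congr' ?_
      filter_upwards [eventually_ge_atTop N] with n hn
      rw [min_eq_left (hN.le.trans (by exact_mod_cast hn))]
  -- Truncation increases the weight while keeping it at most 1, so every truncated rate lies
  -- between 0 and `-log Z`.
  refine tendsto_integral_of_dominated_convergence
    (fun x => -Real.log (∫ y, expNeg (ENNReal.ofReal lam * D (x, y)) ∂Q))
    (fun n => (measurable_gibbsRate (hm n)).aestronglyMeasurable) hlog.neg (fun n => ?_) ?_
  · filter_upwards [hpos] with x hx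
    have hx1 : ∫ y, expNeg (ENNReal.ofReal lam * D (x, y)) ∂Q ≤
        ∫ y, Real.exp (-lam * (min (D (x, y)) n).toReal) ∂Q :=
      integral_mono_of_nonneg (Eventually.of_forall fun y => expNeg_nonneg _)
        (Integrable.of_bound (hm' n x) 1 (Eventually.of_forall fun y => habs n _))
        (Eventually.of_forall fun y => hge n _)
    have h2 := gibbsRate_le (hm' n x) (fun y => (Real.exp_pos _).le) (fun y => h1 n _)
      (hx.trans_le hx1)
    have h3 := Real.log_le_log hx hx1
    rw [Real.norm_eq_abs, abs_of_nonneg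
      (gibbsRate_nonneg (hm' n x) (fun y => (Real.exp_pos _).le) (fun y => h1 n _))]
    rw [Real.log_one] at h2
    linarith
  · filter_upwards [hpos] with x hx
    exact tendsto_gibbsRate (hm' · x) (fun n y => habs n _)
      (Eventually.of_forall fun y => hlim _) hx

end GibbsRate

/-! ### Uniform laws of large numbers -/

/-- The difference from the Lipschitz ramp `max 0 (min 1 t)` is continuous and vanishes at infinity.
-/
lemma IsSquashing.uniformContinuous {σ : ℝ → ℝ} (hσ : IsSquashing σ) : UniformContinuous σ := by
  have h1 : UniformContinuous fun t : ℝ => max 0 (min 1 t) :=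
    ((LipschitzWith.id.const_min 1).const_max 0).uniformContinuous
  have h2 : UniformContinuous fun t => σ t - max 0 (min 1 t) := by
    refine Continuous.uniformContinuous_of_tendsto_cocompact
      (hσ.continuous.sub h1.continuous) (x := 0) ?_
    rw [cocompact_eq_atBot_atTop, tendsto_sup]
    constructor
    · have h3 : Tendsto (fun t : ℝ => max 0 (min 1 t)) atBot (𝓝 0) := by
        refine tendsto_const_nhds.congr' ?_
        filter_upwards [eventually_le_atBot 0] with t ht
        rw [min_eq_right (ht.trans zero_le_one), max_eq_left ht]
      simpa using hσ.tendsto_atBot.sub h3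
    · have h3 : Tendsto (fun t : ℝ => max 0 (min 1 t)) atTop (𝓝 1) := by
        refine tendsto_const_nhds.congr' ?_
        filter_upwards [eventually_ge_atTop 1] with t ht
        rw [min_eq_left ht, max_eq_right zero_le_one]
      simpa using hσ.tendsto_atTop.sub h3
  simpa using h2.add h1

lemma ridge_uniformContinuous {σ : ℝ → ℝ} {d : ℕ} (hσ : IsSquashing σ) :
    ∀ f ∈ ridge σ d, UniformContinuous f := by
  intro f hf
  induction hf using Submodule.span_induction with
  | mem f hf =>
    obtain ⟨ab, rfl⟩ := hf
    refine hσ.uniformContinuous.comp (UniformContinuous.add ?_ uniformContinuous_const)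
    let L : (Fin d → ℝ) →L[ℝ] ℝ := ∑ i, ab.1 i • ContinuousLinearMap.proj i
    have hL : ∀ x, L x = ∑ i, ab.1 i * x i := fun x => by simp [L]
    simp only [← hL]
    exact L.uniformContinuous
  | zero => exact uniformContinuous_const
  | add f g _ _ h1 h2 => exact h1.add h2
  | smul c f _ h1 => exact h1.const_smul c

/-- The uniform law of large numbers, from the strong law in a space of bounded functions. -/
lemma uniform_strong_law {𝒳 𝒵 Ω : Type*} [TopologicalSpace 𝒳] [TopologicalSpace 𝒵]
    [SecondCountableTopology 𝒵] [MeasurableSpace 𝒵] [BorelSpace 𝒵] [MeasurableSpace Ω]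
    {μ : Measure Ω} [IsProbabilityMeasure μ] {ν : Measure 𝒵} (Φ : 𝒵 → BoundedContinuousFunction 𝒳 ℝ)
    (hΦ : Continuous Φ) {C : ℝ} (hC : ∀ z, ‖Φ z‖ ≤ C) (Z : ℕ → Ω → 𝒵) (hZ : ∀ j, Measurable (Z j))
    (hlaw : ∀ j, μ.map (Z j) = ν) (hind : iIndepFun Z μ) :
    ∀ᵐ ω ∂μ, TendstoUniformly (fun (m : ℕ) x => (1 / (m : ℝ)) * ∑ j ∈ Finset.range m, Φ (Z j ω) x)
      (fun x => ∫ z, Φ z x ∂ν) atTop := by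
  borelize (BoundedContinuousFunction 𝒳 ℝ)
  -- The bounded continuous functions need not form a separable space; a continuous map from the
  -- second countable `𝒵` is strongly measurable all the same.
  have hsm : StronglyMeasurable Φ := hΦ.stronglyMeasurable
  have hν : IsProbabilityMeasure ν := by
    rw [← hlaw 0]; exact Measure.isProbabilityMeasure_map (hZ 0).aemeasurable
  have hiν : Integrable Φ ν :=
    Integrable.of_bound hsm.aestronglyMeasurable C (Eventually.of_forall hC)
  have hi : Integrable (Φ ∘ Z 0) μ := by
    rw [← hlaw 0] at hiν
    exact hiν.comp_measurable (hZ 0)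
  have hlln := strong_law_ae (μ := μ) (fun j => Φ ∘ Z j) hi
    (fun i j hij => (hind.indepFun hij).comp hΦ.measurable hΦ.measurable)
    (fun j => IdentDistrib.comp ⟨(hZ j).aemeasurable, (hZ 0).aemeasurable,
      (hlaw j).trans (hlaw 0).symm⟩ hΦ.measurable)
  filter_upwards [hlln] with ω hω
  rw [BoundedContinuousFunction.tendsto_iff_tendstoUniformly] at hω
  have h1 : ∫ w, (Φ ∘ Z 0) w ∂μ = ∫ z, Φ z ∂ν := by
    rw [← hlaw 0, integral_map (hZ 0).aemeasurable hsm.aestronglyMeasurable]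
    rfl
  -- Evaluation at `x` is a continuous linear form and so commutes with the Bochner integral.
  have h2 : (fun x => ∫ z, Φ z x ∂ν) = ⇑(∫ w, (Φ ∘ Z 0) w ∂μ) := by
    ext x
    rw [h1]
    exact (BoundedContinuousFunction.evalCLM ℝ x).integral_comp_comm hiν
  rw [h2]
  have h3 : (fun (m : ℕ) x => (1 / (m : ℝ)) * ∑ j ∈ Finset.range m, Φ (Z j ω) x) =
      fun m : ℕ => ⇑((m : ℝ)⁻¹ • ∑ j ∈ Finset.range m, (Φ ∘ Z j) ω) := by
    ext m x
    simp
  rw [h3]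
  exact hω

/-- Joint uniform continuity makes `z ↦ H (·, T z)` continuous for the uniform norm. -/
lemma continuous_boundedContinuous_slice {𝒳 𝒴 𝒵 : Type*} [PseudoMetricSpace 𝒳]
    [PseudoMetricSpace 𝒴] [TopologicalSpace 𝒵] (H : 𝒳 × 𝒴 → ℝ) (hH : UniformContinuous H) {C : ℝ}
    (hC : ∀ w, |H w| ≤ C) (T : 𝒵 → 𝒴) (hT : Continuous T) :
    ∃ Φ : 𝒵 → BoundedContinuousFunction 𝒳 ℝ, Continuous Φ ∧ (∀ z, ‖Φ z‖ ≤ max C 0) ∧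
      ∀ z x, Φ z x = H (x, T z) := by
  refine ⟨fun z => BoundedContinuousFunction.ofNormedAddCommGroup (fun x => H (x, T z))
    (hH.continuous.comp (by fun_prop)) C fun x => hC _, ?_, fun z => ?_, fun z x => rfl⟩
  · refine continuous_iff_continuousAt.2 fun z₀ => Metric.tendsto_nhds.2 fun η hη => ?_
    obtain ⟨δ, hδ, h⟩ := Metric.uniformContinuous_iff.1 hH (η / 2) (half_pos hη)
    filter_upwards [Metric.tendsto_nhds.1 (hT.tendsto z₀) δ hδ] with z hz
    refine lt_of_le_of_lt ((BoundedContinuousFunction.dist_le (half_pos hη).le).2 fun x => ?_)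
      (half_lt_self hη)
    refine (h ?_).le
    rw [Prod.dist_eq, dist_self]
    exact max_lt hδ hz
  · exact (BoundedContinuousFunction.norm_le (le_max_right _ _)).2 fun x =>
      (hC (x, T z)).trans (le_max_left _ _)

/-! ### Consistency of the empirical rate for a fixed bounded distortion estimator -/

/-- The rate of the empirical Gibbs law of the first `m` base samples. -/
noncomputable def empRate {𝒳 𝒴 𝒵 : Type*} (lam : ℝ) (g : 𝒳 → 𝒴 → ℝ) (T : 𝒵 → 𝒴) (z : ℕ → 𝒵)
    (m : ℕ) (x : 𝒳) : ℝ :=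
  -Real.log ((1 / (m : ℝ)) * ∑ j ∈ Finset.range m, Real.exp (-lam * g x (T (z j)))) +
    ((1 / (m : ℝ)) * ∑ j ∈ Finset.range m,
      Real.exp (-lam * g x (T (z j))) * (-lam * g x (T (z j)))) /
    ((1 / (m : ℝ)) * ∑ j ∈ Finset.range m, Real.exp (-lam * g x (T (z j))))

/-- The logarithm of a Gibbs weight is `-lam * g`, so subtracting `lam` times the weighted
distortion produces the entropy term. The condition `m ≠ 0` allows the factor `1 / m` to cancel in
the ratio. -/
lemma empR_eq {𝒳 𝒴 𝒵 : Type*} (lam : ℝ) (g : 𝒳 → 𝒴 → ℝ) (T : 𝒵 → 𝒴) (x : ℕ → 𝒳) (z : ℕ → 𝒵)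
    (n : ℕ) {m : ℕ} (hm : m ≠ 0) :
    empR lam g T x z n m = (1 / (n : ℝ)) * ∑ i ∈ Finset.range n, empRate lam g T z m (x i) := by
  have h1 : ∀ i, empRate lam g T z m (x i) =
      -Real.log ((1 / (m : ℝ)) * ∑ j ∈ Finset.range m, Real.exp (-lam * g (x i) (T (z j)))) -
      lam * ∑ j ∈ Finset.range m, g (x i) (T (z j)) * (Real.exp (-lam * g (x i) (T (z j))) /
        ∑ j' ∈ Finset.range m, Real.exp (-lam * g (x i) (T (z j')))) := by
    intro i
    have hm' : (1 / (m : ℝ)) ≠ 0 := by positivity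
    rw [empRate, mul_div_mul_left _ _ hm', sub_eq_add_neg, Finset.sum_div, ← neg_mul]
    congr 1
    rw [Finset.mul_sum]
    refine Finset.sum_congr rfl fun j _ => ?_
    ring
  simp only [h1, empR, empL, empD, Finset.sum_sub_distrib, Finset.sum_neg_distrib,
    ← Finset.mul_sum]
  ring

lemma uniformContinuousOn_rate {c : ℝ} (hc : 0 < c) (A B : ℝ) :
    UniformContinuousOn (fun w : ℝ × ℝ => -Real.log w.1 + w.2 / w.1)
      (Set.Icc c A ×ˢ Set.Icc (-B) B) := by
  refine (isCompact_Icc.prod isCompact_Icc).uniformContinuousOn_of_continuous ?_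
  have h0 : ∀ w ∈ Set.Icc c A ×ˢ Set.Icc (-B) B, w.1 ≠ 0 := fun w hw =>
    (hc.trans_le hw.1.1).ne'
  exact ((continuousOn_fst.log h0).neg).add (continuousOn_snd.div continuousOn_fst h0)

lemma average_mem_Icc {a b : ℝ} {m : ℕ} (hm : m ≠ 0) {f : ℕ → ℝ} (h : ∀ j, f j ∈ Set.Icc a b) :
    (1 / (m : ℝ)) * ∑ j ∈ Finset.range m, f j ∈ Set.Icc a b := by
  have hm' : (0 : ℝ) < m := by positivity
  rw [one_div, inv_mul_eq_div]
  constructor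
  · rw [le_div_iff₀ hm', mul_comm]
    simpa using Finset.card_nsmul_le_sum (Finset.range m) f a fun j _ => (h j).1
  · rw [div_le_iff₀ hm', mul_comm]
    simpa using Finset.sum_le_card_nsmul (Finset.range m) f b fun j _ => (h j).2

section Consistency

variable {𝒳 𝒴 𝒵 : Type*} [PseudoMetricSpace 𝒳] [PseudoMetricSpace 𝒴] [TopologicalSpace 𝒵]
  [SecondCountableTopology 𝒵] [MeasurableSpace 𝒵] [BorelSpace 𝒵]

/-- The rate is a function of two sample means, each converging uniformly in `x`. Bounds on `g` keep
both in a compact rectangle with first coordinate away from 0, where that function is uniformly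
continuous. -/
lemma tendstoUniformly_empRate {Ω : Type*} [MeasurableSpace Ω] {μ : Measure Ω}
    [IsProbabilityMeasure μ] (lam : ℝ) (g : 𝒳 → 𝒴 → ℝ)
    (hg : UniformContinuous (Function.uncurry g)) {C : ℝ} (hC : ∀ x y, |g x y| ≤ C) (T : 𝒵 → 𝒴)
    (hT : Continuous T) {ν : Measure 𝒵} (Z : ℕ → Ω → 𝒵) (hZ : ∀ j, Measurable (Z j))
    (hlaw : ∀ j, μ.map (Z j) = ν) (hind : iIndepFun Z μ) :
    ∀ᵐ ω ∂μ, TendstoUniformly (fun (m : ℕ) x => empRate lam g T (fun j => Z j ω) m x)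
      (fun x => gibbsRate ν fun z => Real.exp (-lam * g x (T z))) atTop := by
  have hν : IsProbabilityMeasure ν := by
    rw [← hlaw 0]; exact Measure.isProbabilityMeasure_map (hZ 0).aemeasurable
  have hcomp : ∀ ψ : ℝ → ℝ, Continuous ψ → UniformContinuous (ψ ∘ Function.uncurry g) := by
    intro ψ hψ
    have h1 := (isCompact_Icc (a := -C) (b := C)).uniformContinuousOn_of_continuous
      hψ.continuousOn
    have h2 := h1.comp hg.uniformContinuousOn (s := Set.univ)
      (fun w _ => abs_le.1 (hC w.1 w.2))
    exact uniformContinuousOn_univ.1 h2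
  set c := Real.exp (-(|lam| * C)) with hc
  set A := Real.exp (|lam| * C) with hA
  have hlg : ∀ x y, |-lam * g x y| ≤ |lam| * C := fun x y => by
    rw [abs_mul, abs_neg]; exact mul_le_mul_of_nonneg_left (hC x y) (abs_nonneg _)
  have hb1 : ∀ x y, Real.exp (-lam * g x y) ∈ Set.Icc c A := fun x y =>
    ⟨Real.exp_le_exp.2 (abs_le.1 (hlg x y)).1, Real.exp_le_exp.2 (abs_le.1 (hlg x y)).2⟩
  have hb2 : ∀ x y, Real.exp (-lam * g x y) * (-lam * g x y) ∈
      Set.Icc (-(A * (|lam| * C))) (A * (|lam| * C)) := fun x y => by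
    rw [Set.mem_Icc, ← abs_le, abs_mul, abs_of_pos (Real.exp_pos _)]
    exact mul_le_mul (hb1 x y).2 (hlg x y) (abs_nonneg _) (Real.exp_pos _).le
  obtain ⟨Φ, hΦ, hΦb, hΦe⟩ := continuous_boundedContinuous_slice _
    (hcomp (fun t => Real.exp (-lam * t)) (by fun_prop)) (C := A)
    (fun w => by
      simp only [Function.comp]
      rw [abs_of_pos (Real.exp_pos _)]; exact (hb1 w.1 w.2).2) T hT
  obtain ⟨Ψ, hΨ, hΨb, hΨe⟩ := continuous_boundedContinuous_slice _
    (hcomp (fun t => Real.exp (-lam * t) * (-lam * t)) (by fun_prop)) (C := A * (|lam| * C))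
    (fun w => abs_le.2 (hb2 w.1 w.2)) T hT
  simp only [Function.comp, Function.uncurry] at hΦe hΨe
  filter_upwards [uniform_strong_law Φ hΦ hΦb Z hZ hlaw hind,
    uniform_strong_law Ψ hΨ hΨb Z hZ hlaw hind] with ω h1 h2
  simp only [hΦe] at h1
  simp only [hΨe] at h2
  have h3 : TendstoUniformly (fun (m : ℕ) x =>
      ((1 / (m : ℝ)) * ∑ j ∈ Finset.range m, Real.exp (-lam * g x (T (Z j ω))),
        (1 / (m : ℝ)) * ∑ j ∈ Finset.range m,
          Real.exp (-lam * g x (T (Z j ω))) * (-lam * g x (T (Z j ω)))))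
      (fun x => (∫ z, Real.exp (-lam * g x (T z)) ∂ν,
        ∫ z, Real.exp (-lam * g x (T z)) * (-lam * g x (T z)) ∂ν)) atTop := by
    intro s hs
    exact (tendsto_id.prodMk tendsto_id).eventually ((h1.prodMk h2) s hs)
  have h4 : ∀ᶠ m : ℕ in atTop, ∀ x,
      ((1 / (m : ℝ)) * ∑ j ∈ Finset.range m, Real.exp (-lam * g x (T (Z j ω))),
        (1 / (m : ℝ)) * ∑ j ∈ Finset.range m,
          Real.exp (-lam * g x (T (Z j ω))) * (-lam * g x (T (Z j ω)))) ∈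
        Set.Icc c A ×ˢ Set.Icc (-(A * (|lam| * C))) (A * (|lam| * C)) := by
    filter_upwards [eventually_ne_atTop 0] with m hm x
    exact ⟨average_mem_Icc hm fun j => hb1 _ _, average_mem_Icc hm fun j => hb2 _ _⟩
  have h5 : ∀ x, (∫ z, Real.exp (-lam * g x (T z)) ∂ν,
        ∫ z, Real.exp (-lam * g x (T z)) * (-lam * g x (T z)) ∂ν) ∈
        Set.Icc c A ×ˢ Set.Icc (-(A * (|lam| * C))) (A * (|lam| * C)) := fun x =>
    (isClosed_Icc.prod isClosed_Icc).mem_of_tendsto (h3.tendsto_at x)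
      (h4.mono fun m hm => hm x)
  have h6 := (uniformContinuousOn_rate (Real.exp_pos _) A _).comp_tendstoUniformly_eventually
    h4 h5 h3
  simpa only [empRate, gibbsRate, Real.log_exp] using h6

/-- **Strong consistency** of the empirical rate for a fixed bounded uniformly continuous
distortion estimator and a fixed continuous reproduction mapping. -/
theorem empR_consistent {𝒮 Ω : Type*} [MeasurableSpace 𝒳] [BorelSpace 𝒳] [MeasurableSpace 𝒴]
    [BorelSpace 𝒴] [SecondCountableTopology 𝒳] [SecondCountableTopology 𝒴]
    [MeasurableSpace 𝒮] [MeasurableSpace Ω] {μ : Measure Ω} [IsProbabilityMeasure μ] (lam : ℝ)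
    (g : 𝒳 → 𝒴 → ℝ) (hg : UniformContinuous (Function.uncurry g)) {C : ℝ}
    (hC : ∀ x y, |g x y| ≤ C) (T : 𝒵 → 𝒴) (hT : Continuous T) {P : Measure (𝒳 × 𝒮)}
    {ν : Measure 𝒵} (XS : ℕ → Ω → 𝒳 × 𝒮) (Z : ℕ → Ω → 𝒵)
    (hXS : ∀ i, Measurable (XS i)) (hP : ∀ i, μ.map (XS i) = P) (hXSind : iIndepFun XS μ)
    (hZ : ∀ j, Measurable (Z j)) (hlaw : ∀ j, μ.map (Z j) = ν) (hind : iIndepFun Z μ)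
    {ε : ℝ} (hε : 0 < ε) :
    ∀ᵐ ω ∂μ, ∃ N M : ℕ, ∀ n ≥ N, ∀ m ≥ M,
      |empR lam g T (fun i => (XS i ω).1) (fun j => Z j ω) n m -
        ∫ x, gibbsRate ν (fun z => Real.exp (-lam * g x (T z))) ∂P.fst| ≤ ε := by
  have hν : IsProbabilityMeasure ν := by
    rw [← hlaw 0]; exact Measure.isProbabilityMeasure_map (hZ 0).aemeasurable
  have hPP : IsProbabilityMeasure P := by
    rw [← hP 0]; exact Measure.isProbabilityMeasure_map (hXS 0).aemeasurable
  set r : 𝒳 → ℝ := fun x => gibbsRate ν fun z => Real.exp (-lam * g x (T z)) with hr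
  have hU : Measurable (Function.uncurry fun x z => Real.exp (-lam * g x (T z))) := by
    have : Measurable fun w : 𝒳 × 𝒵 => Function.uncurry g (w.1, T w.2) :=
      hg.continuous.measurable.comp (measurable_fst.prodMk (hT.measurable.comp measurable_snd))
    exact Real.measurable_exp.comp (this.const_mul (-lam))
  have hrm : Measurable r := measurable_gibbsRate hU
  have hlg : ∀ x y, |-lam * g x y| ≤ |lam| * C := fun x y => by
    rw [abs_mul, abs_neg]; exact mul_le_mul_of_nonneg_left (hC x y) (abs_nonneg _)
  have hrb : ∀ x, |r x| ≤ _ := fun x => abs_gibbsRate_le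
    (hU.comp measurable_prodMk_left).aestronglyMeasurable (Real.exp_pos (-(|lam| * C)))
    (C := Real.exp (|lam| * C)) fun z => ⟨Real.exp_le_exp.2 (abs_le.1 (hlg x (T z))).1,
      Real.exp_le_exp.2 (abs_le.1 (hlg x (T z))).2⟩
  have hφ : Measurable fun w : 𝒳 × 𝒮 => r w.1 := hrm.comp measurable_fst
  have hlln := strong_law_ae_real (μ := μ) (fun i ω => r (XS i ω).1)
    (Integrable.of_bound (hφ.comp (hXS 0)).aestronglyMeasurable _
      (Eventually.of_forall fun ω => hrb _))
    (fun i j hij => (hXSind.indepFun hij).comp hφ hφ)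
    (fun j => IdentDistrib.comp (u := fun w : 𝒳 × 𝒮 => r w.1)
      ⟨(hXS j).aemeasurable, (hXS 0).aemeasurable, (hP j).trans (hP 0).symm⟩ hφ)
  have hmean : ∫ ω, r (XS 0 ω).1 ∂μ = ∫ x, r x ∂P.fst := by
    rw [← hP 0, Measure.fst, integral_map measurable_fst.aemeasurable hrm.aestronglyMeasurable,
      integral_map (hXS 0).aemeasurable hφ.aestronglyMeasurable]
  rw [hmean] at hlln
  filter_upwards [hlln, tendstoUniformly_empRate lam g hg hC T hT Z hZ hlaw hind] with ω h1 h2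
  obtain ⟨N, hN⟩ := Metric.tendsto_atTop.1 h1 (ε / 2) (half_pos hε)
  obtain ⟨M, hM⟩ := eventually_atTop.1
    (Metric.tendstoUniformly_iff.1 h2 (ε / 2) (half_pos hε))
  refine ⟨max N 1, max M 1, fun n hn m hm => ?_⟩
  have hn' : n ≠ 0 := by have := (le_max_right N 1).trans hn; omega
  have hm' : m ≠ 0 := by have := (le_max_right M 1).trans hm; omega
  rw [empR_eq _ _ _ _ _ _ hm']
  have h3 := hN n ((le_max_left N 1).trans hn)
  rw [Real.dist_eq] at h3
  -- The bound `ε / 2` holds at every point `x`, hence for the average over any number of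
  -- observations; `M` is thus independent of `n`.
  have h4 := average_mem_Icc hn' (a := -(ε / 2)) (b := ε / 2)
    (f := fun i => empRate lam g T (fun j => Z j ω) m (XS i ω).1 - r (XS i ω).1) fun i => by
      rw [Set.mem_Icc, ← abs_le, ← Real.dist_eq, dist_comm]
      exact (hM m ((le_max_left M 1).trans hm) _).le
  rw [Set.mem_Icc, ← abs_le, Finset.sum_sub_distrib, mul_sub] at h4
  rw [div_eq_inv_mul, ← one_div] at h3
  calc _ ≤ _ := abs_sub_le _ ((1 / (n : ℝ)) * ∑ i ∈ Finset.range n, r (XS i ω).1) _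
    _ ≤ ε / 2 + ε / 2 := add_le_add h4 h3.le
    _ = ε := add_halves ε

end Consistency

/-! ### Approximation of a transport map -/

/-- Networks are dense almost everywhere. -/
lemma exists_ridge_tendsto_ae {σ : ℝ → ℝ} (hσ : IsSquashing σ) {d : ℕ} (μ : Measure (Fin d → ℝ))
    [IsFiniteMeasure μ] {f : (Fin d → ℝ) → ℝ} (hf : Measurable f) :
    ∃ t : ℕ → (Fin d → ℝ) → ℝ, (∀ n, t n ∈ ridge σ d) ∧
      ∀ᵐ z ∂μ, Tendsto (fun n => t n z) atTop (𝓝 (f z)) := by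
  -- A gauge of convergence in measure. Capping at 1 makes it continuous along every pointwise
  -- limit, so `I t < η` is an open condition.
  let I : ((Fin d → ℝ) → ℝ) → ℝ≥0∞ := fun t => ∫⁻ z, ENNReal.ofReal (min 1 |t z - f z|) ∂μ
  have hI : ∀ (t : ℕ → (Fin d → ℝ) → ℝ) (s : (Fin d → ℝ) → ℝ), (∀ n, Measurable (t n)) →
      (∀ z, Tendsto (fun n => t n z) atTop (𝓝 (s z))) → Tendsto (fun n => I (t n)) atTop (𝓝 (I s)) := by
    intro t s ht hlim
    refine tendsto_lintegral_of_dominated_convergence (fun _ => 1)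
      (fun n => (measurable_const.min ((ht n).sub hf).norm).ennreal_ofReal)
      (fun n => Eventually.of_forall fun z => ?_) (by simp) (Eventually.of_forall fun z => ?_)
    · exact ENNReal.ofReal_le_one.2 (min_le_left _ _)
    · refine (ENNReal.continuous_ofReal.tendsto _).comp ?_
      exact tendsto_const_nhds.min ((hlim z).sub_const _).abs
  have hmeas : ∀ g ∈ (ridge σ d : Set ((Fin d → ℝ) → ℝ)), Measurable g := fun g hg =>
    (ridge_continuous hσ g hg).measurable
  have hex : ∀ η : ℝ≥0∞, 0 < η → ∃ t ∈ ridge σ d, I t < η := by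
    intro η hη
    have h1 : Tendsto (fun n : ℕ => I fun z => max (-(n : ℝ)) (min n (f z))) atTop (𝓝 (I f)) := by
      refine hI _ _ (fun n => measurable_const.max (measurable_const.min hf)) fun z => ?_
      obtain ⟨N, hN⟩ := exists_nat_ge |f z|
      refine tendsto_const_nhds.congr' ?_
      filter_upwards [eventually_ge_atTop N] with n hn
      have h2 := abs_le.1 (hN.trans (Nat.cast_le.2 hn))
      rw [min_eq_right h2.2, max_eq_right h2.1]
    have h0 : I f = 0 := by simp [I]
    rw [h0] at h1
    obtain ⟨n, hn⟩ := (h1.eventually_lt_const hη).exists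
    refine BddClosure.exists_mem_of_open (fun t => I t < η) ?_
      (ridge_closure_measurable hσ (measurable_const.max (measurable_const.min hf)) (C := n) ?_) hn
    · intro t s C ht _ hlim hs
      exact ((hI t s (fun n => (ht n).measurable hmeas) hlim).eventually_lt_const hs).exists
    · exact fun z => abs_le.2 ⟨le_max_left _ _, max_le (by simp) (min_le_left _ _)⟩
  -- Geometric errors make the sum of the capped differences finite almost everywhere, so they tend
  -- to 0 without passing to a subsequence.
  choose t ht htI using fun n : ℕ => hex ((2⁻¹ : ℝ≥0∞) ^ n)
    (pos_iff_ne_zero.2 (pow_ne_zero _ (by simp)))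
  refine ⟨t, ht, ?_⟩
  have hm : ∀ n, Measurable fun z => ENNReal.ofReal (min 1 |t n z - f z|) := fun n =>
    (measurable_const.min ((hmeas _ (ht n)).sub hf).norm).ennreal_ofReal
  have hsum : ∫⁻ z, ∑' n, ENNReal.ofReal (min 1 |t n z - f z|) ∂μ ≠ ∞ := by
    rw [lintegral_tsum fun n => (hm n).aemeasurable]
    refine ne_top_of_le_ne_top ?_ (ENNReal.tsum_le_tsum fun n => (htI n).le)
    rw [ENNReal.tsum_geometric_two]
    simp
  filter_upwards [ae_lt_top (Measurable.tsum hm) hsum] with z hz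
  have h1 := ENNReal.tendsto_atTop_zero_of_tsum_ne_top hz.ne
  rw [tendsto_iff_norm_sub_tendsto_zero]
  have h2 : Tendsto (fun n => min 1 |t n z - f z|) atTop (𝓝 0) := by
    have := (ENNReal.tendsto_toReal ENNReal.zero_ne_top).comp h1
    refine this.congr fun n => ?_
    simp only [Function.comp]
    rw [ENNReal.toReal_ofReal (le_min zero_le_one (abs_nonneg _))]
  refine h2.congr' ?_
  filter_upwards [h2.eventually_lt_const zero_lt_one] with n hn
  rw [min_eq_right (min_lt_iff.1 hn |>.resolve_left (lt_irrefl _)).le, Real.norm_eq_abs]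

/-- Maps that are close in probability have image laws that are close in the Lévy–Prokhorov
distance. -/
lemma levyProkhorovEDist_map_le {α β : Type*} [MeasurableSpace α] [PseudoMetricSpace β]
    [MeasurableSpace β] [BorelSpace β] [SecondCountableTopology β] (μ : Measure α)
    [IsProbabilityMeasure μ] {T T' : α → β} (hT : Measurable T) (hT' : Measurable T') {ε : ℝ≥0∞}
    (hε : ε ≠ ∞) (h : μ {z | ε.toReal ≤ dist (T z) (T' z)} ≤ ε) :
    levyProkhorovEDist (μ.map T) (μ.map T') ≤ ε := by
  have : IsProbabilityMeasure (μ.map T) := Measure.isProbabilityMeasure_map hT.aemeasurable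
  have : IsProbabilityMeasure (μ.map T') := Measure.isProbabilityMeasure_map hT'.aemeasurable
  refine levyProkhorovEDist_le_of_forall_le _ _ _ fun δ B hδ hδt hB => ?_
  rw [Measure.map_apply hT hB, Measure.map_apply hT' Metric.isOpen_thickening.measurableSet]
  have hsub : T ⁻¹' B ⊆ T' ⁻¹' Metric.thickening δ.toReal B ∪
      {z | ε.toReal ≤ dist (T z) (T' z)} := by
    intro z hz
    by_cases hzd : ε.toReal ≤ dist (T z) (T' z)
    · exact Or.inr hzd
    · refine Or.inl (Metric.mem_thickening_iff.2 ⟨T z, hz, ?_⟩)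
      rw [dist_comm]
      exact (not_le.1 hzd).trans ((ENNReal.toReal_lt_toReal hε hδt.ne).2 hδ)
  exact (measure_mono hsub).trans ((measure_union_le _ _).trans (add_le_add_right (h.trans hδ.le) _))

lemma gibbsRate_map {α β : Type*} [MeasurableSpace α] [MeasurableSpace β] (μ : Measure α)
    {T : α → β} (hT : Measurable T) {u : β → ℝ} (hu : Measurable u) :
    gibbsRate (μ.map T) u = gibbsRate μ (u ∘ T) := by
  simp only [gibbsRate]
  have h : Measurable fun y => u y * Real.log (u y) := hu.mul (Real.measurable_log.comp hu)
  rw [integral_map hT.aemeasurable hu.aestronglyMeasurable,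
    integral_map hT.aemeasurable h.aestronglyMeasurable]
  rfl

/-! ### The rate at an optimal channel -/

section Optimal

variable {p : ℕ} {S Y : Type*} [MeasurableSpace S] [StandardBorelSpace S] [Nonempty S]
  [MeasurableSpace Y] (P : Measure ((Fin p → ℝ) × S)) [IsProbabilityMeasure P]
  (d : S × Y → ℝ≥0∞)

lemma measurable_dbar (hd : Measurable d) :
    Measurable fun w : (Fin p → ℝ) × Y => dbar P d w.1 w.2 := by
  have h1 : Measurable (Function.uncurry fun (w : (Fin p → ℝ) × Y) (s : S) => d (s, w.2)) :=
    hd.comp (measurable_snd.prodMk (measurable_snd.comp measurable_fst))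
  exact Measurable.lintegral_kernel_prod_right (κ := P.condKernel.comap Prod.fst measurable_fst) h1

lemma expDistortion_eq (hd : Measurable d) (κ : Kernel (Fin p → ℝ) Y) [IsSFiniteKernel κ] :
    expDistortion P d κ = ∫⁻ w, dbar P d w.1 w.2 ∂(P.fst ⊗ₘ κ) :=
  (Measure.lintegral_compProd (measurable_dbar P d hd)).symm

variable {P d} {lam : ℝ} {κ : Kernel (Fin p → ℝ) Y} [IsMarkovKernel κ]

/-- Supporting-line argument: among channels with no larger distortion, a smaller mutual information
would lower the Lagrangian. Cancelling the distortion term requires it to be finite. -/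
lemma iRDF_eq_mutualInfo (hκ : IsOptimalChannel P d lam κ) :
    iRDF P d (expDistortion P d κ) = mutualInfo P.fst κ := by
  have hfin : ENNReal.ofReal lam * expDistortion P d κ ≠ ∞ := fun h =>
    hκ.1 (by rw [lagrangian, h, add_top])
  refine le_antisymm (iInf_le_of_le κ (iInf_le_of_le inferInstance (iInf_le _ le_rfl))) ?_
  refine le_iInf fun κ' => le_iInf fun hκ' => le_iInf fun hD => ?_
  have h1 := (hκ.2 κ' hκ').trans (add_le_add_right (mul_le_mul_right hD _) _)
  exact (ENNReal.add_le_add_iff_right hfin).1 h1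

/-- At slope 0 distortion costs nothing, and a constant channel carries no information. -/
lemma mutualInfo_eq_zero (hκ : IsOptimalChannel P d 0 κ) : mutualInfo P.fst κ = 0 := by
  have h1 := hκ.2 (Kernel.const _ (κ ∘ₘ P.fst)) inferInstance
  simp only [lagrangian, ENNReal.ofReal_zero, zero_mul, add_zero] at h1
  refine le_antisymm (h1.trans (le_of_eq ?_)) zero_le
  rw [mutualInfo, reproLaw, Measure.compProd_const, Measure.const_comp, measure_univ, one_smul,
    klDiv_self]

/-- The rate-distortion function at an optimal channel is the limit of the mean Gibbs rates of
the truncated distortion measures. -/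
lemma tendsto_gibbsRate_iRDF (hd : Measurable d) (hlam : 0 ≤ lam) (hκ : IsOptimalChannel P d lam κ) :
    Tendsto (fun n : ℕ => ∫ x, gibbsRate (reproLaw P.fst κ)
        (fun y => Real.exp (-lam * (min (dbar P d x y) n).toReal)) ∂P.fst) atTop
      (𝓝 (iRDF P d (expDistortion P d κ)).toReal) := by
  have hQ : IsProbabilityMeasure (reproLaw P.fst κ) := by unfold reproLaw; infer_instance
  rw [iRDF_eq_mutualInfo hκ]
  -- Slope 0 is separate because `0 * ∞ = 0`, whereas the truncation lemma needs `lam * ∞ = ∞`. All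
  -- weights are then 1 and all rates 0.
  rcases hlam.eq_or_lt with rfl | hlam
  · rw [mutualInfo_eq_zero hκ]
    simp [gibbsRate]
  have hD := measurable_dbar P d hd
  have he : ∀ κ' : Kernel (Fin p → ℝ) Y, IsMarkovKernel κ' →
      ∫⁻ w, ENNReal.ofReal lam * dbar P d w.1 w.2 ∂(P.fst ⊗ₘ κ') =
        ENNReal.ofReal lam * expDistortion P d κ' := fun κ' _ => by
    rw [lintegral_const_mul _ hD, expDistortion_eq P d hd]
  obtain ⟨h1, h2, h3⟩ := optimal_channel_gibbs P.fst κ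
    (fun w => ENNReal.ofReal lam * dbar P d w.1 w.2) (hD.const_mul _)
    (by rw [he κ inferInstance]; exact hκ.1)
    (fun κ' hκ' => by rw [he κ inferInstance, he κ' hκ']; exact hκ.2 κ' hκ')
  have h4 : (mutualInfo P.fst κ).toReal = _ := h3
  rw [h4]
  exact tendsto_integral_gibbsRate_truncate hlam (fun w => dbar P d w.1 w.2) hD h1 h2

end Optimal

/-! ### Approximation of the distortion measure -/

lemma uniformContinuous_append (p q : ℕ) :
    UniformContinuous fun w : (Fin p → ℝ) × (Fin q → ℝ) => Fin.append w.1 w.2 := by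
  refine uniformContinuous_pi.2 fun i => ?_
  induction i using Fin.addCases with
  | left i =>
    simp only [Fin.append_left]
    exact (Pi.uniformContinuous_proj _ i).comp uniformContinuous_fst
  | right i =>
    simp only [Fin.append_right]
    exact (Pi.uniformContinuous_proj _ i).comp uniformContinuous_snd

lemma measurable_append {p q : ℕ} {Y : Set (Fin q → ℝ)} :
    Measurable fun w : (Fin p → ℝ) × Y => Fin.append w.1 (w.2 : Fin q → ℝ) :=
  (uniformContinuous_append p q).continuous.measurable.comp
    (measurable_fst.prodMk (measurable_subtype_coe.comp measurable_snd))

/-- A bounded measurable function on `ℝ^p × Y` extends to `ℝ^(p+q)`. -/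
lemma exists_extend_append {p q : ℕ} {Y : Set (Fin q → ℝ)} (hY : MeasurableSet Y)
    {h : (Fin p → ℝ) × Y → ℝ} (hh : Measurable h) {C : ℝ} (hC : ∀ w, |h w| ≤ C) :
    ∃ f : (Fin (p + q) → ℝ) → ℝ, Measurable f ∧ (∀ v, |f v| ≤ |C|) ∧
      ∀ w : (Fin p → ℝ) × Y, f (Fin.append w.1 (w.2 : Fin q → ℝ)) = h w := by
  have hemb : MeasurableEmbedding
      (Prod.map id Subtype.val : (Fin p → ℝ) × Y → (Fin p → ℝ) × (Fin q → ℝ)) :=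
    MeasurableEmbedding.id.prodMap (MeasurableEmbedding.subtype_coe hY)
  obtain ⟨F, hF, hFe⟩ := hemb.exists_measurable_extend hh (fun _ => ⟨0⟩)
  refine ⟨fun v => max (-|C|) (min |C| (F (fun i => v (Fin.castAdd q i), fun i => v (Fin.natAdd p i)))),
    ?_, fun v => abs_le.2 ⟨le_max_left _ _, max_le (by simp) (min_le_left _ _)⟩, fun w => ?_⟩
  · refine measurable_const.max (measurable_const.min (hF.comp ?_))
    exact (measurable_pi_lambda _ fun i => measurable_pi_apply _).prodMk
      (measurable_pi_lambda _ fun i => measurable_pi_apply _)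
  · simp only [Fin.append_left, Fin.append_right]
    have h1 : F (w.1, (w.2 : Fin q → ℝ)) = h w := congrFun hFe w
    have h2 := abs_le.1 ((hC w).trans (le_abs_self C))
    rw [h1, min_eq_right h2.2, max_eq_right h2.1]

/-- A bounded measurable function on `ℝ^p × Y` is approximated by networks, in mean and such that
the mean Gibbs rates are close. -/
lemma exists_ridge_close {σ : ℝ → ℝ} (hσ : IsSquashing σ) {p q : ℕ} {Y : Set (Fin q → ℝ)}
    (hY : MeasurableSet Y) (μ : Measure (Fin p → ℝ)) [IsProbabilityMeasure μ] (Q : Measure Y)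
    [IsProbabilityMeasure Q] (lam : ℝ) {h : (Fin p → ℝ) × Y → ℝ} (hh : Measurable h) {C : ℝ}
    (hC : ∀ w, |h w| ≤ C) {η : ℝ} (hη : 0 < η) :
    ∃ G ∈ ridge σ (p + q),
      ∫ w, |G (Fin.append w.1 (w.2 : Fin q → ℝ)) - h w| ∂(μ.prod Q) < η ∧
      |∫ x, gibbsRate Q (fun y => Real.exp (-lam * G (Fin.append x (y : Fin q → ℝ)))) ∂μ -
        ∫ x, gibbsRate Q (fun y => Real.exp (-lam * h (x, y))) ∂μ| < η := by
  obtain ⟨f, hf, hfb, hfe⟩ := exists_extend_append hY hh hC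
  have hmeas : ∀ g ∈ (ridge σ (p + q) : Set ((Fin (p + q) → ℝ) → ℝ)), Measurable g := fun g hg =>
    (ridge_continuous hσ g hg).measurable
  -- Both quantities are continuous under bounded pointwise limits and vanish at the extension `f`
  -- of `h`, so some network satisfies both bounds at once.
  refine BddClosure.exists_mem_of_open (fun G : (Fin (p + q) → ℝ) → ℝ =>
    ∫ w, |G (Fin.append w.1 (w.2 : Fin q → ℝ)) - h w| ∂(μ.prod Q) < η ∧
      |∫ x, gibbsRate Q (fun y => Real.exp (-lam * G (Fin.append x (y : Fin q → ℝ)))) ∂μ -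
        ∫ x, gibbsRate Q (fun y => Real.exp (-lam * h (x, y))) ∂μ| < η) ?_
    (ridge_closure_measurable hσ hf hfb) ?_
  · rintro F G B hF hB hlim ⟨h1, h2⟩
    have hFm : ∀ n, Measurable fun w : (Fin p → ℝ) × Y => F n (Fin.append w.1 (w.2 : Fin q → ℝ)) :=
      fun n => ((hF n).measurable hmeas).comp measurable_append
    have h3 : Tendsto (fun n => ∫ w, |F n (Fin.append w.1 (w.2 : Fin q → ℝ)) - h w| ∂(μ.prod Q)) atTop
        (𝓝 (∫ w, |G (Fin.append w.1 (w.2 : Fin q → ℝ)) - h w| ∂(μ.prod Q))) := by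
      refine tendsto_integral_of_dominated_convergence (fun _ => B + C)
        (fun n => ((hFm n).sub hh).norm.aestronglyMeasurable) (integrable_const _)
        (fun n => Eventually.of_forall fun w => ?_)
        (Eventually.of_forall fun w => ((hlim _).sub_const _).abs)
      rw [Real.norm_eq_abs, abs_abs]
      exact (abs_sub _ _).trans (add_le_add (hB n _) (hC w))
    have h4 : Tendsto (fun n => ∫ x, gibbsRate Q
          (fun y => Real.exp (-lam * F n (Fin.append x (y : Fin q → ℝ)))) ∂μ) atTop
        (𝓝 (∫ x, gibbsRate Q (fun y => Real.exp (-lam * G (Fin.append x (y : Fin q → ℝ)))) ∂μ)) := by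
      refine tendsto_integral_gibbsRate (c := Real.exp (-(|lam| * B))) (C := Real.exp (|lam| * B))
        (fun n => Real.measurable_exp.comp ((hFm n).const_mul (-lam))) (Real.exp_pos _)
        (fun n x y => ?_) (Eventually.of_forall fun x => Eventually.of_forall fun y => ?_)
      · have h5 : |-lam * F n (Fin.append x (y : Fin q → ℝ))| ≤ |lam| * B := by
          rw [abs_mul, abs_neg]; exact mul_le_mul_of_nonneg_left (hB n _) (abs_nonneg _)
        exact ⟨Real.exp_le_exp.2 (abs_le.1 h5).1, Real.exp_le_exp.2 (abs_le.1 h5).2⟩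
      · exact (Real.continuous_exp.tendsto _).comp ((hlim _).const_mul _)
    exact ((h3.eventually_lt_const h1).and
      (((h4.sub_const _).abs).eventually_lt_const h2)).exists
  · simp only [hfe, sub_self, abs_zero, integral_zero]
    have h5 : ∀ x (y : Y), f (Fin.append x (y : Fin q → ℝ)) = h (x, y) := fun x y => hfe (x, y)
    simp only [h5, sub_self, abs_zero]
    exact ⟨hη, hη⟩

/-- A function close in mean to a sufficiently truncated extended function is close to it in
measure. -/
lemma measure_not_closeTo_le {W : Type*} [MeasurableSpace W] (μ : Measure W)
    [IsProbabilityMeasure μ] (D : W → ℝ≥0∞) {ε : ℝ} (hε : 0 < ε) {n : ℕ} (hn : 1 / ε + 1 ≤ n)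
    (hDn : μ {w | (n : ℝ≥0∞) ≤ D w ∧ D w ≠ ∞} ≤ ENNReal.ofReal (ε / 2)) {G : W → ℝ}
    (hG : Integrable (fun w => |G w - (min (D w) n).toReal|) μ)
    (hGn : ∫ w, |G w - (min (D w) n).toReal| ∂μ ≤ min ε 1 * (ε / 2)) :
    μ {w | ¬ CloseTo ε (G w) (D w)} ≤ ENNReal.ofReal ε := by
  have hδ : 0 < min ε 1 := lt_min hε one_pos
  -- An error below `ε` settles finite values below the truncation level; an error below 1 settles
  -- infinite ones, where `G > n - 1 ≥ 1 / ε`. Markov's inequality bounds the rest.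
  have hsub : {w | ¬ CloseTo ε (G w) (D w)} ⊆ {w | (n : ℝ≥0∞) ≤ D w ∧ D w ≠ ∞} ∪
      {w | min ε 1 ≤ |G w - (min (D w) n).toReal|} := by
    intro w hw
    by_contra hcon
    simp only [Set.mem_union, Set.mem_ofPred_eq, not_or, not_and, not_not, not_le] at hcon
    refine hw ⟨fun hfin => ?_, fun htop => ?_⟩
    · have h1 : D w ≤ n := by
        by_contra h
        exact hfin (hcon.1 (not_le.1 h).le)
      have h2 := hcon.2
      rw [min_eq_left h1] at h2
      exact h2.le.trans (min_le_left _ _)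
    · have h2 := hcon.2.trans_le (min_le_right _ _)
      rw [htop, min_eq_right le_top, ENNReal.toReal_natCast] at h2
      have := (abs_lt.1 h2).1
      linarith
  have hM : μ {w | min ε 1 ≤ |G w - (min (D w) n).toReal|} ≤ ENNReal.ofReal (ε / 2) := by
    have h1 := mul_meas_ge_le_integral_of_nonneg (Eventually.of_forall fun w => abs_nonneg _) hG
      (min ε 1)
    have h2 := le_of_mul_le_mul_left (h1.trans hGn) hδ
    rw [← ofReal_measureReal]
    exact ENNReal.ofReal_le_ofReal h2
  calc _ ≤ _ := measure_mono hsub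
    _ ≤ _ := measure_union_le _ _
    _ ≤ _ := add_le_add hDn hM
    _ = ENNReal.ofReal ε := by
      rw [← ENNReal.ofReal_add (by positivity) (by positivity), add_halves]

lemma tendsto_measure_ge_natCast {W : Type*} [MeasurableSpace W] (μ : Measure W)
    [IsFiniteMeasure μ] {D : W → ℝ≥0∞} (hD : Measurable D) :
    Tendsto (fun n : ℕ => μ {w | (n : ℝ≥0∞) ≤ D w ∧ D w ≠ ∞}) atTop (𝓝 0) := by
  have h1 := tendsto_measure_iInter_atTop (μ := μ)
    (s := fun n : ℕ => {w | (n : ℝ≥0∞) ≤ D w ∧ D w ≠ ∞})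
    (fun n => ((measurableSet_le measurable_const hD).inter
      (hD (measurableSet_singleton ∞).compl)).nullMeasurableSet)
    (fun m n hmn w hw => ⟨(Nat.cast_le.2 hmn).trans hw.1, hw.2⟩) ⟨0, measure_ne_top _ _⟩
  have h2 : ⋂ n : ℕ, {w | (n : ℝ≥0∞) ≤ D w ∧ D w ≠ ∞} = ∅ := by
    refine Set.eq_empty_of_forall_notMem fun w hw => ?_
    rw [Set.mem_iInter] at hw
    obtain ⟨N, hN⟩ := ENNReal.exists_nat_gt (hw 0).2
    exact absurd (hw N).1 (not_le.2 hN)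
  rw [h2, measure_empty] at h1
  exact h1

/-- Networks transport the base law close to a prescribed law, such that the mean Gibbs rates of
a bounded continuous distortion estimator are close. -/
lemma exists_ridge_transport {σ : ℝ → ℝ} (hσ : IsSquashing σ) {p q l : ℕ}
    (PZ : Measure (Fin l → ℝ)) [IsProbabilityMeasure PZ] [NullSingletonClass PZ]
    (Q : Measure (Fin q → ℝ)) [IsProbabilityMeasure Q] (μ : Measure (Fin p → ℝ))
    [IsProbabilityMeasure μ] (lam : ℝ) {g : (Fin p → ℝ) → (Fin q → ℝ) → ℝ}
    (hg : Continuous (Function.uncurry g)) {B : ℝ} (hB : ∀ x y, |g x y| ≤ B) {ε : ℝ} (hε : 0 < ε)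
    {η : ℝ} (hη : 0 < η) :
    ∃ T : (Fin l → ℝ) → (Fin q → ℝ), (∀ o, (fun z => T z o) ∈ ridge σ l) ∧
      levyProkhorovEDist (PZ.map T) Q ≤ ENNReal.ofReal ε ∧
      |∫ x, gibbsRate PZ (fun z => Real.exp (-lam * g x (T z))) ∂μ -
        ∫ x, gibbsRate Q (fun y => Real.exp (-lam * g x y)) ∂μ| < η := by
  -- `T₀` is an exact transport. Almost everywhere convergence to it yields closeness of laws
  -- through convergence in measure, and closeness of rates through continuity of `g`.
  obtain ⟨T₀, hT₀, hmap⟩ := exists_measurable_transport PZ Q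
  choose t ht hlim using fun o : Fin q =>
    exists_ridge_tendsto_ae hσ PZ ((measurable_pi_apply o).comp hT₀)
  let T : ℕ → (Fin l → ℝ) → (Fin q → ℝ) := fun n z o => t o n z
  have hTc : ∀ n, Continuous (T n) := fun n =>
    continuous_pi fun o => ridge_continuous hσ _ (ht o n)
  have hTlim : ∀ᵐ z ∂PZ, Tendsto (fun n => T n z) atTop (𝓝 (T₀ z)) := by
    filter_upwards [ae_all_iff.2 hlim] with z hz
    exact tendsto_pi_nhds.2 hz
  have h1 : ∀ᶠ n in atTop, levyProkhorovEDist (PZ.map (T n)) Q ≤ ENNReal.ofReal ε := by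
    have h2 := tendstoInMeasure_of_tendsto_ae (fun n => (hTc n).aestronglyMeasurable) hTlim
    have h3 := tendstoInMeasure_iff_dist.1 h2 ε hε
    filter_upwards [h3.eventually_lt_const (ENNReal.ofReal_pos.2 hε)] with n hn
    rw [← hmap]
    refine levyProkhorovEDist_map_le PZ (hTc n).measurable hT₀ ENNReal.ofReal_ne_top ?_
    rw [ENNReal.toReal_ofReal hε.le]
    exact hn.le
  have hgm : ∀ T' : (Fin l → ℝ) → (Fin q → ℝ), Measurable T' →
      Measurable (Function.uncurry fun x z => Real.exp (-lam * g x (T' z))) := fun T' hT' =>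
    Real.measurable_exp.comp (Measurable.const_mul (hg.measurable.comp
      (measurable_fst.prodMk (hT'.comp measurable_snd))) (-lam))
  have h4 : Tendsto (fun n => ∫ x, gibbsRate PZ (fun z => Real.exp (-lam * g x (T n z))) ∂μ) atTop
      (𝓝 (∫ x, gibbsRate PZ (fun z => Real.exp (-lam * g x (T₀ z))) ∂μ)) := by
    refine tendsto_integral_gibbsRate (c := Real.exp (-(|lam| * B))) (C := Real.exp (|lam| * B))
      (fun n => hgm _ (hTc n).measurable) (Real.exp_pos _) (fun n x z => ?_)
      (Eventually.of_forall fun x => ?_)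
    · have h5 : |-lam * g x (T n z)| ≤ |lam| * B := by
        rw [abs_mul, abs_neg]; exact mul_le_mul_of_nonneg_left (hB _ _) (abs_nonneg _)
      exact ⟨Real.exp_le_exp.2 (abs_le.1 h5).1, Real.exp_le_exp.2 (abs_le.1 h5).2⟩
    · filter_upwards [hTlim] with z hz
      have hc : Continuous fun y => Real.exp (-lam * g x y) :=
        Real.continuous_exp.comp ((hg.comp (Continuous.prodMk_right x)).const_mul (-lam))
      exact (hc.tendsto _).comp hz
  have h6 : ∀ x, gibbsRate Q (fun y => Real.exp (-lam * g x y)) =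
      gibbsRate PZ (fun z => Real.exp (-lam * g x (T₀ z))) := fun x => by
    rw [← hmap, gibbsRate_map PZ hT₀]
    · rfl
    · exact (Real.continuous_exp.comp
        ((hg.comp (Continuous.prodMk_right x)).const_mul (-lam))).measurable
  simp only [h6]
  have h7 := (h4.sub_const (∫ x, gibbsRate PZ (fun z => Real.exp (-lam * g x (T₀ z))) ∂μ)).abs
  rw [sub_self, abs_zero] at h7
  obtain ⟨n, hn1, hn2⟩ := (h1.and (h7.eventually_lt_const hη)).exists
  exact ⟨T n, fun o => ht o n, hn1, hn2⟩

end IndirectRD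

/-! ### Assembly of the approximations -/

open IndirectRD

theorem mainTheorem2 {p q l : ℕ}
    {S : Type*} [MeasurableSpace S] [StandardBorelSpace S] [Nonempty S]
    (P : Measure ((Fin p → ℝ) × S)) [IsProbabilityMeasure P]
    (Y : Set (Fin q → ℝ)) (hY : MeasurableSet Y)
    (d : S × Y → ℝ≥0∞) (hd : Measurable d)
    (PZ : Measure (Fin l → ℝ)) [IsProbabilityMeasure PZ] [NullSingletonClass PZ]
    (σ : ℝ → ℝ) (hσ : IndirectRD.IsSquashing σ)
    (lam : ℝ) (hlam : 0 ≤ lam)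
    (κ : Kernel (Fin p → ℝ) Y) [IsMarkovKernel κ]
    (hκ : IndirectRD.IsOptimalChannel P d lam κ)
    (ε : ℝ) (hε : 0 < ε) :
    IndirectRD.iRDF P d (IndirectRD.expDistortion P d κ) ≠ ∞ ∧
    ∃ k₀ : ℕ, ∀ k ≥ k₀,
      ∃ Θ Θ' : Set (EuclideanSpace ℝ (Fin k)), IsCompact Θ ∧ IsCompact Θ' ∧
      ∃ θ ∈ Θ, ∃ θ' ∈ Θ',
        -- the push-forward of the base law approximates the optimal reproduction law
        levyProkhorovEDist (PZ.map (IndirectRD.reproNet (l := l) (q := q) σ θ))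
            ((IndirectRD.reproLaw P.fst κ).map (Subtype.val : Y → (Fin q → ℝ)))
          ≤ ENNReal.ofReal ε ∧
        -- the distortion estimator approximates the reduced distortion in measure
        (P.fst.prod (IndirectRD.reproLaw P.fst κ))
            {w | ¬ IndirectRD.CloseTo ε (IndirectRD.distNet σ θ' w.1 (w.2 : Fin q → ℝ))
              (IndirectRD.dbar P d w.1 w.2)}
          ≤ ENNReal.ofReal ε ∧
        -- strong consistency of the empirical estimate
        ∀ (Ω : Type*) [MeasurableSpace Ω] (μ : Measure Ω) [IsProbabilityMeasure μ]
          (XS : ℕ → Ω → (Fin p → ℝ) × S) (Z : ℕ → Ω → (Fin l → ℝ)),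
          (∀ i, Measurable (XS i)) → (∀ i, μ.map (XS i) = P) → iIndepFun XS μ →
          (∀ j, Measurable (Z j)) → (∀ j, μ.map (Z j) = PZ) → iIndepFun Z μ →
          ∀ᵐ ω ∂μ, ∃ N M : ℕ, ∀ n ≥ N, ∀ m ≥ M,
            |IndirectRD.empR lam (IndirectRD.distNet (p := p) (q := q) σ θ')
                (IndirectRD.reproNet (l := l) (q := q) σ θ)
                (fun i => (XS i ω).1) (fun j => Z j ω) n m
              - (IndirectRD.iRDF P d (IndirectRD.expDistortion P d κ)).toReal| ≤ ε := by
  have hQ : IsProbabilityMeasure (reproLaw P.fst κ) := by unfold reproLaw; infer_instance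
  have hD := measurable_dbar P d hd
  refine ⟨?_, ?_⟩
  · rw [iRDF_eq_mutualInfo hκ]
    exact fun h => hκ.1 (by rw [lagrangian, h, top_add])
  set Q := reproLaw P.fst κ with hQdef
  have hQv : IsProbabilityMeasure (Q.map (Subtype.val : Y → (Fin q → ℝ))) :=
    Measure.isProbabilityMeasure_map measurable_subtype_coe.aemeasurable
  -- One quarter each for truncation, distortion network, transport network and sampling. The
  -- constant in `hδ` is the one required by Markov's inequality in `measure_not_closeTo_le`.
  have hη : 0 < ε / 4 := by positivity
  have hδ : 0 < min ε 1 * (ε / 2) := mul_pos (lt_min hε one_pos) (half_pos hε)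
  -- the truncation level
  obtain ⟨n, hn1, hn2, hn3⟩ : ∃ n : ℕ, 1 / ε + 1 ≤ n ∧
      (P.fst.prod Q) {w | (n : ℝ≥0∞) ≤ dbar P d w.1 w.2 ∧ dbar P d w.1 w.2 ≠ ∞} ≤
        ENNReal.ofReal (ε / 2) ∧
      |∫ x, gibbsRate Q (fun y => Real.exp (-lam * (min (dbar P d x y) n).toReal)) ∂P.fst -
        (iRDF P d (expDistortion P d κ)).toReal| < ε / 4 := by
    have h1 := ((tendsto_gibbsRate_iRDF hd hlam hκ).sub_const
      (iRDF P d (expDistortion P d κ)).toReal).abs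
    rw [sub_self, abs_zero] at h1
    have h2 := tendsto_measure_ge_natCast (P.fst.prod Q) hD
    obtain ⟨n, h3, h4, h5⟩ := ((tendsto_natCast_atTop_atTop.eventually_ge_atTop (1 / ε + 1)).and
      ((h2.eventually_lt_const (ENNReal.ofReal_pos.2 (half_pos hε))).and
        (h1.eventually_lt_const hη))).exists
    exact ⟨n, h3, h4.le, h5⟩
  -- the distortion estimator
  have hhm : Measurable fun w : (Fin p → ℝ) × Y => (min (dbar P d w.1 w.2) n).toReal :=
    (hD.min measurable_const).ennreal_toReal
  have hhb : ∀ w : (Fin p → ℝ) × Y, |(min (dbar P d w.1 w.2) n).toReal| ≤ n := fun w => by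
    rw [abs_of_nonneg ENNReal.toReal_nonneg]
    simpa using ENNReal.toReal_mono (ENNReal.natCast_ne_top n)
      (min_le_right (dbar P d w.1 w.2) n)
  obtain ⟨G, hG, hG1, hG2⟩ := exists_ridge_close hσ hY P.fst Q lam hhm hhb (lt_min hη hδ)
  obtain ⟨B, hB⟩ := ridge_bounded hσ G hG
  have hguc : UniformContinuous (Function.uncurry fun (x : Fin p → ℝ) (y : Fin q → ℝ) =>
      G (Fin.append x y)) :=
    (ridge_uniformContinuous hσ G hG).comp (uniformContinuous_append p q)
  -- the reproduction mapping
  obtain ⟨T, hT, hT1, hT2⟩ := exists_ridge_transport hσ PZ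
    (Q.map (Subtype.val : Y → (Fin q → ℝ))) P.fst lam
    (g := fun x y => G (Fin.append x y)) hguc.continuous (fun x y => hB _) hε hη
  have hTc : Continuous T := continuous_pi fun o => ridge_continuous hσ _ (hT o)
  obtain ⟨k₁, hk₁⟩ := exists_net_eq T hT
  obtain ⟨k₂, hk₂⟩ := exists_net_eq (b := 1) (fun w _ => G w) (fun _ => hG)
  refine ⟨max k₁ k₂, fun k hk => ?_⟩
  obtain ⟨θ, hθ⟩ := hk₁ k ((le_max_left _ _).trans hk)
  obtain ⟨θ', hθ'⟩ := hk₂ k ((le_max_right _ _).trans hk)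
  have hnetT : reproNet (l := l) (q := q) σ θ = T := funext hθ
  have hnetG : distNet (p := p) (q := q) σ θ' = fun x y => G (Fin.append x y) := by
    ext x y
    rw [distNet, hθ']
  -- The parameters are fixed before any sample space is introduced, so singletons serve as the
  -- compact sets.
  refine ⟨{θ}, {θ'}, isCompact_singleton, isCompact_singleton, θ, rfl, θ', rfl, ?_, ?_, ?_⟩
  · rw [hnetT]; exact hT1
  · rw [hnetG]
    refine measure_not_closeTo_le (P.fst.prod Q) (fun w => dbar P d w.1 w.2) hε hn1 hn2
      (G := fun w => G (Fin.append w.1 (w.2 : Fin q → ℝ))) ?_ (hG1.le.trans (min_le_right _ _))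
    refine Integrable.of_bound (C := B + n) ?_ (Eventually.of_forall fun w => ?_)
    · exact ((((ridge_continuous hσ G hG).measurable.comp measurable_append).sub
        hhm).norm).aestronglyMeasurable
    · rw [Real.norm_eq_abs, abs_abs]
      exact (abs_sub _ _).trans (add_le_add (hB _) (hhb w))
  · intro Ω _ μ _ XS Z hXS hP hXSind hZ hlaw hind
    rw [hnetT, hnetG]
    filter_upwards [empR_consistent lam (fun x y => G (Fin.append x y)) hguc (fun x y => hB _) T hTc
      XS Z hXS hP hXSind hZ hlaw hind hη] with ω hω
    obtain ⟨N, M, hNM⟩ := hω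
    refine ⟨N, M, fun n' hn' m hm => ?_⟩
    have h1 := hNM n' hn' m hm
    have h2 : ∀ x, gibbsRate (Q.map (Subtype.val : Y → (Fin q → ℝ)))
        (fun y => Real.exp (-lam * G (Fin.append x y))) =
        gibbsRate Q (fun y => Real.exp (-lam * G (Fin.append x (y : Fin q → ℝ)))) := fun x => by
      rw [gibbsRate_map Q measurable_subtype_coe]
      · rfl
      · exact (Real.continuous_exp.comp
          ((hguc.continuous.comp (Continuous.prodMk_right x)).const_mul (-lam))).measurable
    simp only [h2] at hT2
    have h3 := hG2.trans_le (min_le_left _ _)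
    rw [abs_le] at h1 ⊢
    rw [abs_lt] at hT2 h3 hn3
    constructor <;> linarith [h1.1, h1.2, hT2.1, hT2.2, h3.1, h3.2, hn3.1, hn3.2]
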